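/- Theorem 1 (Network mean-square-error stability). Consider $K$ agents and fix a probability distribution of a feature–label pair $(\boldsymbol{x},\boldsymbol{y})\in\mathbb{R}^M\times\mathbb{R}$, a perturbation radius $\epsilon\ge 0$, and measurable losses $Q_k(w;x,y)$, $k=1,\dots,K$, with $w\in\mathbb{R}^M$, differentiable in $w$ and in $x$. Let $A=[a_{\ell k}]$ be the $K\times K$ combination matrix, with $a_{\ell k}\ge 0$ and $\sum_\ell a_{\ell k}=1$ for every $k$; assume that its graph is strongly connected (any agent is joined to any other by a path with nonzero weights) and that $a_{kk}>0$ for at least one $k$. Let $\pi$ be the Perron vector of $A$: $A\pi=\pi$, $\pi_k>0$, $\sum_k\pi_k=1$. Put $$J_k(w)=\mathbb{E}\max_{\|\delta\|\le\epsilon}Q_k(w;\boldsymbol{x}+\delta,\boldsymbol{y}),\qquad J(w)=\sum_{k=1}^K\pi_kJ_k(w),$$ where these expectations are assumed finite, as well as $\mathbb{E}\|\nabla_wQ_k(w;\boldsymbol{x},\boldsymbol{y})\|^2$, for all $k$ and $w$. Let $w^\star$ be the minimizer of $J$ (the robust model). Assume, for all agents $k,\ell$ and all $w,w_1,w_2,x,x_1,x_2\in\mathbb{R}^M$,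 $y,y_1,y_2\in\mathbb{R}$ and $\|\delta\|\le\epsilon$: 1. (strong convexity, $\nu>0$) $Q_k(w_2;x,y)\ge Q_k(w_1;x,y)+\nabla_wQ_k(w_1;x,y)^{\sf T}(w_2-w_1)+\frac{\nu}{2}\|w_2-w_1\|^2$; 2. (smoothness) $\|\nabla_wQ_k(w_2;x+\delta,y)-\nabla_wQ_k(w_1;x+\delta,y)\|\le L_1\|w_2-w_1\|$, $\|\nabla_wQ_k(w;x_2+\delta,y)-\nabla_wQ_k(w;x_1+\delta,y)\|\le L_2\|x_2-x_1\|$, $\|\nabla_wQ_k(w;x+\delta,y_2)-\nabla_wQ_k(w;x+\delta,y_1)\|\le L_3|y_2-y_1|$, $\|\nabla_xQ_k(w_2;x+\delta,y)-\nabla_xQ_k(w_1;x+\delta,y)\|\le L_4\|w_2-w_1\|$, $\|\nabla_xQ_k(w;x_2+\delta,y)-\nabla_xQ_k(w;x_1+\delta,y)\|\le L_5\|x_2-x_1\|$; 3. (bounded gradient disagreement) $\mathbb{E}\|\nabla_wQ_k(w;\boldsymbol{x}+\delta,\boldsymbol{y})-\nabla_wQ_\ell(w;\boldsymbol{x}+\delta,\boldsymbol{y})\|^2\le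 C^2$. The samples $(\boldsymbol{x}_{k,n},\boldsymbol{y}_{k,n})$ are independent over agents and time and have the given distribution. Starting from square-integrable initial models $\boldsymbol{w}_{k,0}$ that are independent of the samples, the agents run, for $n\ge1$, the adversarial adapt-then-combine diffusion recursion with step size $\mu$: $$\boldsymbol{\delta}^\star_{k,n}\in\mathop{\mathrm{argmax}}_{\|\delta\|\le\epsilon}Q_k(\boldsymbol{w}_{k,n-1};\boldsymbol{x}_{k,n}+\delta,\boldsymbol{y}_{k,n}),$$ $$\boldsymbol{\phi}_{k,n}=\boldsymbol{w}_{k,n-1}-\mu\nabla_wQ_k(\boldsymbol{w}_{k,n-1};\boldsymbol{x}_{k,n}+\boldsymbol{\delta}^\star_{k,n},\boldsymbol{y}_{k,n}),\qquad \boldsymbol{w}_{k,n}=\sum_{\ell}a_{\ell k}\boldsymbol{\phi}_{\ell,n}.$$ The worst-case perturbation $\boldsymbol{\delta}^\star_{k,n}$ is assumed to be almost surely unique for all $k$ and $n$. Then the network converges to an $O(\mu)$-neighborhood of $w^\star$ at an exponential rate, for all sufficiently small $\mu$: there are constants $\mu_0>0$, $a>0$ with $a\mu_0<1$, and $b,c$,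 which do not depend on $\mu$, on the initial models, on $k$ or on $n$, such that for every $0<\mu\le\mu_0$ all $\boldsymbol{w}_{k,n}$ are square-integrable, $$\limsup_{n\to\infty}\mathbb{E}\|w^\star-\boldsymbol{w}_{k,n}\|^2\le c\,\mu\qquad\text{for every agent }k,$$ and $$\mathbb{E}\|w^\star-\boldsymbol{w}_{k,n}\|^2\le b\Big(\sum_{\ell=1}^K\mathbb{E}\|w^\star-\boldsymbol{w}_{\ell,0}\|^2\Big)(1-a\mu)^n+c\,\mu\qquad\text{for every agent }k\text{ and all }n\ge0.$$ -/

import Mathlib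

open MeasureTheory ProbabilityTheory Filter Topology

namespace AdvDiffusion

/-- The Euclidean space `ℝ^M` of models, features and perturbations. -/
abbrev E (M : ℕ) : Type := EuclideanSpace ℝ (Fin M)

/-- A loss function `Q(w; x, y)` with model `w`, feature vector `x` and scalar label `y`. -/
abbrev Loss (M : ℕ) : Type := E M → E M → ℝ → ℝ

section Losses

variable {M : ℕ}

/-- `∇_w Q(w; x, y)`. -/
noncomputable def gradW (q : Loss M) (w x : E M) (y : ℝ) : E M :=
  gradient (fun v => q v x y) w

/-- `∇_x Q(w; x, y)`. -/
noncomputable def gradX (q : Loss M) (w x : E M) (y : ℝ) : E M :=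
  gradient (fun v => q w v y) x

/-- The adversarial loss `max_{‖δ‖ ≤ ε} Q(w; x + δ, y)`.  For `Q` continuous in `x` and `0 ≤ ε` the
supremum is over a nonempty compact set, so it is attained. -/
noncomputable def advLoss (q : Loss M) (ε : ℝ) (w x : E M) (y : ℝ) : ℝ :=
  ⨆ δ : Metric.closedBall (0 : E M) ε, q w (x + δ) y

/-- The adversarial risk `E max_{‖δ‖ ≤ ε} Q(w; x + δ, y)` when `(x, y)` has distribution `D`. -/
noncomputable def advRisk (q : Loss M) (ε : ℝ) (D : Measure (E M × ℝ)) (w : E M) : ℝ :=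
  ∫ z, advLoss q ε w z.1 z.2 ∂D

/-- `δ ∈ argmax_{‖δ'‖ ≤ ε} Q(w; x + δ', y)`. -/
def IsWorstCase (q : Loss M) (ε : ℝ) (w x : E M) (y : ℝ) (δ : E M) : Prop :=
  ‖δ‖ ≤ ε ∧ ∀ δ' : E M, ‖δ'‖ ≤ ε → q w (x + δ') y ≤ q w (x + δ) y

/-- The loss is differentiable in `w`, and `ν`-strongly convex in `w`, for all `x` and `y`. -/
structure StronglyConvexLoss (q : Loss M) (ν : ℝ) : Prop where
  differentiable_w : ∀ x y, Differentiable ℝ (fun w => q w x y)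
  strong_convexity : ∀ (w₁ w₂ x : E M) (y : ℝ),
    q w₁ x y + inner ℝ (gradW q w₁ x y) (w₂ - w₁) + ν / 2 * ‖w₂ - w₁‖ ^ 2 ≤ q w₂ x y

/-- The loss is differentiable in `x`, and its gradients relative to `w` and `x` are Lipschitz
with the stated constants. -/
structure SmoothLoss (q : Loss M) (ε L₁ L₂ L₃ L₄ L₅ : ℝ) : Prop where
  differentiable_x : ∀ w y, Differentiable ℝ (fun x => q w x y)
  gradW_w : ∀ (w₁ w₂ x δ : E M) (y : ℝ), ‖δ‖ ≤ ε →
    ‖gradW q w₂ (x + δ) y - gradW q w₁ (x + δ) y‖ ≤ L₁ * ‖w₂ - w₁‖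
  gradW_x : ∀ (w x₁ x₂ δ : E M) (y : ℝ), ‖δ‖ ≤ ε →
    ‖gradW q w (x₂ + δ) y - gradW q w (x₁ + δ) y‖ ≤ L₂ * ‖x₂ - x₁‖
  gradW_y : ∀ (w x δ : E M) (y₁ y₂ : ℝ), ‖δ‖ ≤ ε →
    ‖gradW q w (x + δ) y₂ - gradW q w (x + δ) y₁‖ ≤ L₃ * ‖y₂ - y₁‖
  gradX_w : ∀ (w₁ w₂ x δ : E M) (y : ℝ), ‖δ‖ ≤ ε →
    ‖gradX q w₂ (x + δ) y - gradX q w₁ (x + δ) y‖ ≤ L₄ * ‖w₂ - w₁‖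
  gradX_x : ∀ (w x₁ x₂ δ : E M) (y : ℝ), ‖δ‖ ≤ ε →
    ‖gradX q w (x₂ + δ) y - gradX q w (x₁ + δ) y‖ ≤ L₅ * ‖x₂ - x₁‖

/-- Standing regularity with respect to the data distribution: the loss is measurable, the
adversarial risk is a finite expectation, and the stochastic gradient has a finite second
moment. -/
structure RegularLoss (q : Loss M) (ε : ℝ) (D : Measure (E M × ℝ)) : Prop where
  measurable : Measurable (fun p : E M × E M × ℝ => q p.1 p.2.1 p.2.2)
  integrable_advLoss : ∀ w, Integrable (fun z : E M × ℝ => advLoss q ε w z.1 z.2) D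
  memLp_gradW : ∀ w, MemLp (fun z : E M × ℝ => gradW q w z.1 z.2) 2 D

/-- The mean-square disagreement of the gradients of two losses is at most `C ^ 2`. -/
def BoundedDisagreement (q q' : Loss M) (ε : ℝ) (D : Measure (E M × ℝ)) (C : ℝ) : Prop :=
  ∀ w δ : E M, ‖δ‖ ≤ ε →
    Integrable (fun z : E M × ℝ =>
      ‖gradW q w (z.1 + δ) z.2 - gradW q' w (z.1 + δ) z.2‖ ^ 2) D ∧
    ∫ z, ‖gradW q w (z.1 + δ) z.2 - gradW q' w (z.1 + δ) z.2‖ ^ 2 ∂D ≤ C ^ 2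

end Losses

section Network

variable {K M : ℕ}

/-- The combination matrix is left-stochastic, its graph is strongly connected, and at least one
agent has a self-loop. -/
structure StronglyConnected (A : Matrix (Fin K) (Fin K) ℝ) : Prop where
  nonneg : ∀ l k, 0 ≤ A l k
  column_sum : ∀ k, ∑ l, A l k = 1
  path : ∀ l k, Relation.ReflTransGen (fun i j => A i j ≠ 0) l k
  self_loop : ∃ k, 0 < A k k

/-- `π` is the Perron vector of `A`: positive entries adding up to one, and `A π = π`. -/
structure IsPerronVector (A : Matrix (Fin K) (Fin K) ℝ) (π : Fin K → ℝ) : Prop where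
  pos : ∀ k, 0 < π k
  sum_eq_one : ∑ k, π k = 1
  eigen : A.mulVec π = π

/-- The aggregate adversarial risk `J(w) = ∑ k, π k * J_k(w)`. -/
noncomputable def aggRisk (Q : Fin K → Loss M) (ε : ℝ) (D : Measure (E M × ℝ)) (π : Fin K → ℝ)
    (w : E M) : ℝ :=
  ∑ k, π k * advRisk (Q k) ε D w

variable {Ω : Type*} [MeasurableSpace Ω]

/-- The samples `ξ n k = (x, y)` are independent over time and agents, with common law `D`. -/
structure IIDSamples (ξ : ℕ → Fin K → Ω → E M × ℝ) (D : Measure (E M × ℝ)) (P : Measure Ω) :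
    Prop where
  measurable : ∀ n k, Measurable (ξ n k)
  law : ∀ n k, P.map (ξ n k) = D
  indep : iIndepFun (fun p : ℕ × Fin K => ξ p.1 p.2) P

/-- The initial models are square-integrable random vectors that are jointly independent of the
samples. -/
structure AdmissibleInit (w₀ : Fin K → Ω → E M) (ξ : ℕ → Fin K → Ω → E M × ℝ) (P : Measure Ω) :
    Prop where
  measurable : ∀ k, Measurable (w₀ k)
  memLp : ∀ k, MemLp (w₀ k) 2 P
  indep : IndepFun (fun ω k => w₀ k ω) (fun ω (p : ℕ × Fin K) => ξ p.1 p.2 ω) P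

/-- `w` and `δ` are the models and the perturbations generated by adversarial adapt-then-combine
diffusion with step size `μ`.  The step from `w n` to `w (n + 1)` uses the samples `ξ n k` and the
perturbations `δ n k`; agent `l` contributes the adapted model
`w n l - μ ∇_w Q_l(w n l; x + δ n l, y)`. Agents outside the neighborhood of `k` have `A l k = 0`. -/
structure IsAdvATC (A : Matrix (Fin K) (Fin K) ℝ) (Q : Fin K → Loss M) (ε μ : ℝ)
    (ξ : ℕ → Fin K → Ω → E M × ℝ) (P : Measure Ω) (w δ : ℕ → Fin K → Ω → E M) : Prop where
  worst_case : ∀ᵐ ω ∂P, ∀ n k,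
    IsWorstCase (Q k) ε (w n k ω) (ξ n k ω).1 (ξ n k ω).2 (δ n k ω)
  combine : ∀ᵐ ω ∂P, ∀ n k, w (n + 1) k ω =
    ∑ l, A l k •
      (w n l ω - μ • gradW (Q l) (w n l ω) ((ξ n l ω).1 + δ n l ω) (ξ n l ω).2)

/-- Almost surely, the worst-case perturbations along the trajectory `w` are unique. -/
def UniqueWorstCase (Q : Fin K → Loss M) (ε : ℝ) (ξ : ℕ → Fin K → Ω → E M × ℝ) (P : Measure Ω)
    (w : ℕ → Fin K → Ω → E M) : Prop :=
  ∀ᵐ ω ∂P, ∀ n k, ∃! d : E M, IsWorstCase (Q k) ε (w n k ω) (ξ n k ω).1 (ξ n k ω).2 d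

end Network

end AdvDiffusion

/-! Split the error of each agent into the error of the centroid `wavg π w` and the deviation of the
agents from the centroid.

Since `A π = π`, combining leaves the centroid unchanged, so the centroid moves by `-μ` times the
averaged stochastic gradient. The adversarial loss need not be differentiable, but the gradient of
`Q` at a worst-case perturbation is a strongly convex subgradient of it
(`IsWorstCase.advLoss_add_inner_le`). Hence the step correlates with the direction to `wstar` up to
the excess adversarial loss at the centroid, minus an error paid for by the deviation
(`IsWorstCase.neg_inner_le`). The models at time `n` are independent of the samples used next, so in
expectation the excess loss becomes excess risk (`integral_advLoss_sub`), which grows quadratically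
around the minimizer (`quadratic_growth_aggRisk`). This independence requires the models to be
measurable functions of the past; uniqueness of the worst case provides it, because a unique
maximizer is the limit of measurably chosen near-maximizers (`exists_measurable_worstCase`).

For the deviation, `A` is primitive, so a power of it contracts vectors of zero average; `mixSq` is
an adapted quadratic form that `A` itself contracts (`StronglyConnected.exists_mixSq_contraction`).
Gradients enter with the factor `μ`, so the deviation obeys a contraction with a source of order `μ
^ 2`.

The two recursions are coupled. The centroid contracts by `1 - O(μ)`, the deviation by a factor
bounded away from 1, and both sources are of order `μ ^ 2`. A suitable combination therefore
contracts by `1 - a * μ` (`exists_coupled_recursion_bound`), which leaves a residual of order `μ ^ 2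
/ μ = μ`. -/

namespace AdvDiffusion

/-! ### Adversarial losses: subgradients, growth of gradients, measurable worst cases -/

section LossLemmas

variable {M : ℕ} {q : Loss M} {ε ν L₁ L₂ L₃ L₄ L₅ : ℝ}

theorem SmoothLoss.continuous_add (hs : SmoothLoss q ε L₁ L₂ L₃ L₄ L₅) (w x : E M) (y : ℝ) :
    Continuous (fun δ => q w (x + δ) y) :=
  (hs.differentiable_x w y).continuous.comp (continuous_const.add continuous_id)

theorem SmoothLoss.exists_isWorstCase (hε : 0 ≤ ε) (hs : SmoothLoss q ε L₁ L₂ L₃ L₄ L₅)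
    (w x : E M) (y : ℝ) : ∃ δ, IsWorstCase q ε w x y δ := by
  obtain ⟨δ, hδ, hmax⟩ := (isCompact_closedBall (0 : E M) ε).exists_isMaxOn
    ⟨0, by simpa using hε⟩ (hs.continuous_add w x y).continuousOn
  refine ⟨δ, by simpa using hδ, fun δ' hδ' => ?_⟩
  exact isMaxOn_iff.1 hmax δ' (by simpa using hδ')

theorem IsWorstCase.advLoss_eq {w x δ : E M} {y : ℝ} (h : IsWorstCase q ε w x y δ) :
    advLoss q ε w x y = q w (x + δ) y := by
  have hδ : δ ∈ Metric.closedBall (0 : E M) ε := by simpa using h.1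
  have hle : ∀ d : Metric.closedBall (0 : E M) ε, q w (x + d) y ≤ q w (x + δ) y :=
    fun d => h.2 d (mem_closedBall_zero_iff.1 d.2)
  have : Nonempty (Metric.closedBall (0 : E M) ε) := ⟨⟨δ, hδ⟩⟩
  refine le_antisymm (ciSup_le hle) ?_
  exact le_ciSup (f := fun d : Metric.closedBall (0 : E M) ε => q w (x + d) y)
    ⟨_, by rintro _ ⟨d, rfl⟩; exact hle d⟩ ⟨δ, hδ⟩

theorem SmoothLoss.le_advLoss (hs : SmoothLoss q ε L₁ L₂ L₃ L₄ L₅)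
    (w x : E M) (y : ℝ) {δ : E M} (hδ : ‖δ‖ ≤ ε) : q w (x + δ) y ≤ advLoss q ε w x y := by
  obtain ⟨δ', h'⟩ := hs.exists_isWorstCase ((norm_nonneg δ).trans hδ) w x y
  rw [h'.advLoss_eq]
  exact h'.2 δ hδ

/-- One half of Danskin's theorem, which needs no uniqueness: freeze the perturbation that is worst
at `w`, use strong convexity there, and note that it is merely admissible at `v`. -/
theorem IsWorstCase.advLoss_add_inner_le (hc : StronglyConvexLoss q ν)
    (hs : SmoothLoss q ε L₁ L₂ L₃ L₄ L₅) {w x δ : E M} {y : ℝ} (h : IsWorstCase q ε w x y δ)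
    (v : E M) :
    advLoss q ε w x y + inner ℝ (gradW q w (x + δ) y) (v - w) + ν / 2 * ‖v - w‖ ^ 2
      ≤ advLoss q ε v x y := by
  rw [h.advLoss_eq]
  exact (hc.strong_convexity w v (x + δ) y).trans (hs.le_advLoss v x y h.1)

/-- The subgradient inequality at the midpoint is used towards both endpoints; the two inner
products cancel. -/
theorem advLoss_midpoint (hε : 0 ≤ ε) (hc : StronglyConvexLoss q ν)
    (hs : SmoothLoss q ε L₁ L₂ L₃ L₄ L₅) (v w x : E M) (y : ℝ) :
    2 * advLoss q ε ((1 / 2 : ℝ) • (v + w)) x y + ν / 4 * ‖w - v‖ ^ 2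
      ≤ advLoss q ε v x y + advLoss q ε w x y := by
  set m := (1 / 2 : ℝ) • (v + w) with hm
  obtain ⟨δ, h⟩ := hs.exists_isWorstCase hε m x y
  have h1 := h.advLoss_add_inner_le hc hs v
  have h2 := h.advLoss_add_inner_le hc hs w
  have e2 : w - m = (1 / 2 : ℝ) • (w - v) := by rw [hm]; module
  have e1 : v - m = -((1 / 2 : ℝ) • (w - v)) := by rw [hm]; module
  rw [e1, inner_neg_right, norm_neg, norm_smul, mul_pow] at h1
  rw [e2, norm_smul, mul_pow] at h2
  have : ‖(1 / 2 : ℝ)‖ ^ 2 = 1 / 4 := by norm_num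
  rw [this] at h1 h2
  linarith

/-- Linear growth in the model, uniformly over perturbations, with a base term that depends only on
the sample. Absolute values appear because the Lipschitz constants are not assumed nonnegative. -/
theorem SmoothLoss.norm_gradW_le (hs : SmoothLoss q ε L₁ L₂ L₃ L₄ L₅) (v w x : E M) {δ : E M}
    (y : ℝ) (hδ : ‖δ‖ ≤ ε) :
    ‖gradW q w (x + δ) y‖ ≤ (‖gradW q v x y‖ + |L₂| * ε) + |L₁| * ‖w - v‖ := by
  have hε : 0 ≤ ε := (norm_nonneg δ).trans hδ
  have h1 := hs.gradW_w v w x δ y hδ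
  have h2 := hs.gradW_x v x (x + δ) 0 y (by simpa using hε)
  simp only [add_zero, add_sub_cancel_left] at h2
  have h3 : L₁ * ‖w - v‖ ≤ |L₁| * ‖w - v‖ := by gcongr; exact le_abs_self _
  have h4 : L₂ * ‖δ‖ ≤ |L₂| * ε := by
    calc L₂ * ‖δ‖ ≤ |L₂| * ‖δ‖ := by gcongr; exact le_abs_self _
      _ ≤ _ := by gcongr
  have h5 : gradW q w (x + δ) y = (gradW q w (x + δ) y - gradW q v (x + δ) y)
      + (gradW q v (x + δ) y - gradW q v x y) + gradW q v x y := by abel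
  have h6 := norm_add₃_le (a := gradW q w (x + δ) y - gradW q v (x + δ) y)
    (b := gradW q v (x + δ) y - gradW q v x y) (c := gradW q v x y)
  rw [← h5] at h6
  linarith

theorem SmoothLoss.continuous_gradW (hε : 0 ≤ ε) (hs : SmoothLoss q ε L₁ L₂ L₃ L₄ L₅) :
    Continuous (fun p : E M × E M × ℝ => gradW q p.1 p.2.1 p.2.2) := by
  rw [continuous_iff_continuousAt]
  rintro ⟨w, x, y⟩
  have h0 : ‖(0 : E M)‖ ≤ ε := by simpa using hε
  rw [ContinuousAt, tendsto_iff_norm_sub_tendsto_zero]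
  have hlim : Tendsto (fun p : E M × E M × ℝ => |L₁| * ‖p.1 - w‖ + |L₂| * ‖p.2.1 - x‖
      + |L₃| * ‖p.2.2 - y‖) (𝓝 (w, x, y)) (𝓝 0) := by
    have : Continuous (fun p : E M × E M × ℝ => |L₁| * ‖p.1 - w‖ + |L₂| * ‖p.2.1 - x‖
      + |L₃| * ‖p.2.2 - y‖) := by fun_prop
    simpa using this.tendsto (w, x, y)
  refine squeeze_zero (fun _ => norm_nonneg _) ?_ hlim
  rintro ⟨w', x', y'⟩
  have h1 := hs.gradW_w w w' x' 0 y' h0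
  have h2 := hs.gradW_x w x x' 0 y' h0
  have h3 := hs.gradW_y w x 0 y y' h0
  simp only [add_zero] at h1 h2 h3
  have h4 : L₁ * ‖w' - w‖ ≤ |L₁| * ‖w' - w‖ := by gcongr; exact le_abs_self _
  have h5 : L₂ * ‖x' - x‖ ≤ |L₂| * ‖x' - x‖ := by gcongr; exact le_abs_self _
  have h6 : L₃ * ‖y' - y‖ ≤ |L₃| * ‖y' - y‖ := by gcongr; exact le_abs_self _
  have h7 : gradW q w' x' y' - gradW q w x y = (gradW q w' x' y' - gradW q w x' y')
      + (gradW q w x' y' - gradW q w x y') + (gradW q w x y' - gradW q w x y) := by abel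
  have h8 := norm_add₃_le (a := gradW q w' x' y' - gradW q w x' y')
    (b := gradW q w x' y' - gradW q w x y') (c := gradW q w x y' - gradW q w x y)
  rw [← h7] at h8
  simp only
  linarith

/-- Continuity in the perturbation makes a countable supremum suffice, so the adversarial loss is
jointly measurable. -/
theorem SmoothLoss.advLoss_eq_iSup_denseSeq (hs : SmoothLoss q ε L₁ L₂ L₃ L₄ L₅)
    [Nonempty (Metric.closedBall (0 : E M) ε)] (w x : E M) (y : ℝ) :
    advLoss q ε w x y = ⨆ i, q w
      (x + (TopologicalSpace.denseSeq (Metric.closedBall (0 : E M) ε) i : E M)) y := by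
  have hcont : Continuous (fun d : Metric.closedBall (0 : E M) ε => q w (x + d) y) :=
    (hs.continuous_add w x y).comp continuous_subtype_val
  have hle : ∀ d : Metric.closedBall (0 : E M) ε, q w (x + d) y ≤ advLoss q ε w x y :=
    fun d => hs.le_advLoss w x y (mem_closedBall_zero_iff.1 d.2)
  refine le_antisymm (le_of_forall_lt fun c hc => ?_) (ciSup_le fun i => hle _)
  obtain ⟨d, hd⟩ := exists_lt_of_lt_ciSup hc
  obtain ⟨i, hi⟩ := (TopologicalSpace.denseRange_denseSeq
    (Metric.closedBall (0 : E M) ε)).exists_mem_open (hcont.isOpen_preimage _ isOpen_Ioi)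
    ⟨d, hd⟩
  exact lt_of_lt_of_le hi (le_ciSup (f := fun i => q w
    (x + (TopologicalSpace.denseSeq (Metric.closedBall (0 : E M) ε) i : E M)) y)
    ⟨_, by rintro _ ⟨i, rfl⟩; exact hle _⟩ i)

theorem RegularLoss.measurable_comp {D : Measure (E M × ℝ)} (hr : RegularLoss q ε D) (d : E M) :
    Measurable (fun p : E M × E M × ℝ => q p.1 (p.2.1 + d) p.2.2) :=
  hr.measurable.comp (by fun_prop :
    Measurable (fun p : E M × E M × ℝ => (p.1, p.2.1 + d, p.2.2)))

theorem RegularLoss.measurable_advLoss (hε : 0 ≤ ε) {D : Measure (E M × ℝ)}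
    (hr : RegularLoss q ε D) (hs : SmoothLoss q ε L₁ L₂ L₃ L₄ L₅) :
    Measurable (fun p : E M × E M × ℝ => advLoss q ε p.1 p.2.1 p.2.2) := by
  have : Nonempty (Metric.closedBall (0 : E M) ε) := ⟨⟨0, by simpa using hε⟩⟩
  simp_rw [hs.advLoss_eq_iSup_denseSeq]
  exact Measurable.iSup fun i => hr.measurable_comp _

/-- If the worst-case perturbation is unique, then it is the limit of near-maximizers. -/
theorem SmoothLoss.tendsto_worstCase (hs : SmoothLoss q ε L₁ L₂ L₃ L₄ L₅) {w x δ : E M} {y : ℝ}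
    (huniq : ∀ d, IsWorstCase q ε w x y d → d = δ)
    {u : ℕ → E M} (hu : ∀ n, ‖u n‖ ≤ ε)
    (hlim : ∀ n : ℕ, advLoss q ε w x y - 1 / ((n : ℝ) + 1) < q w (x + u n) y) :
    Tendsto u atTop (𝓝 δ) := by
  rw [tendsto_nhds]
  intro O hO hδO
  by_contra hcon
  have hK : IsCompact (Metric.closedBall (0 : E M) ε \ O) :=
    (isCompact_closedBall _ _).diff hO
  have hfreq : ∃ᶠ n in atTop, u n ∉ O := by simpa [Filter.Frequently] using hcon
  obtain ⟨n₀, hn₀⟩ := hfreq.exists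
  obtain ⟨d, hd, hmax⟩ := hK.exists_isMaxOn ⟨u n₀, by simpa using hu n₀, hn₀⟩
    (hs.continuous_add w x y).continuousOn
  have hdε : ‖d‖ ≤ ε := by simpa using hd.1
  -- On the compact part of the ball outside `O` the best value misses the maximum by a fixed gap,
  -- by uniqueness; near-maximizers cannot stay there once their tolerance is below the gap.
  have hlt : q w (x + d) y < advLoss q ε w x y := by
    refine lt_of_le_of_ne (hs.le_advLoss w x y hdε) fun heq => hd.2 ?_
    rw [huniq d ⟨hdε, fun δ' hδ' => heq ▸ hs.le_advLoss w x y hδ'⟩]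
    exact hδO
  have hev := (tendsto_one_div_add_atTop_nhds_zero_nat (𝕜 := ℝ)).eventually
    (gt_mem_nhds (sub_pos.2 hlt))
  obtain ⟨n, hnO, hn⟩ := (hfreq.and_eventually hev).exists
  have := isMaxOn_iff.1 hmax (u n) ⟨by simpa using hu n, hnO⟩
  linarith [hlim n]

/-- A measurable map that returns the worst-case perturbation wherever it is unique. -/
theorem exists_measurable_worstCase (hε : 0 ≤ ε) {D : Measure (E M × ℝ)}
    (hr : RegularLoss q ε D) (hs : SmoothLoss q ε L₁ L₂ L₃ L₄ L₅) :
    ∃ s : E M × E M × ℝ → E M, Measurable s ∧ ∀ (w x δ : E M) (y : ℝ),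
      IsWorstCase q ε w x y δ → (∃! d, IsWorstCase q ε w x y d) → s (w, x, y) = δ := by
  classical
  have : Nonempty (Metric.closedBall (0 : E M) ε) := ⟨⟨0, by simpa using hε⟩⟩
  set d : ℕ → E M := fun i => TopologicalSpace.denseSeq (Metric.closedBall (0 : E M) ε) i with hd
  -- The first point of the dense sequence within `1 / (n + 1)` of the supremum depends measurably
  -- on `p`; the selection is the limit of these points.
  have hex : ∀ (n : ℕ) (p : E M × E M × ℝ), ∃ i,
      advLoss q ε p.1 p.2.1 p.2.2 - 1 / ((n : ℝ) + 1) < q p.1 (p.2.1 + d i) p.2.2 := by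
    intro n p
    have h := hs.advLoss_eq_iSup_denseSeq p.1 p.2.1 p.2.2
    refine exists_lt_of_lt_ciSup ?_
    rw [← h]
    have : (0 : ℝ) < 1 / ((n : ℝ) + 1) := by positivity
    linarith
  have hmeas : ∀ n : ℕ, Measurable fun p => d (Nat.find (hex n p)) := fun n =>
    (measurable_from_nat (f := d)).comp (measurable_find (hex n) fun i =>
      measurableSet_lt ((hr.measurable_advLoss hε hs).sub_const _) (hr.measurable_comp _))
  refine ⟨fun p => limUnder atTop fun n => d (Nat.find (hex n p)),
    (StronglyMeasurable.limUnder fun n => (hmeas n).stronglyMeasurable).measurable, ?_⟩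
  intro w x δ y h hu
  refine (hs.tendsto_worstCase (fun d' hd' => hu.unique hd' h) ?_ ?_).limUnder_eq
  · intro n
    exact mem_closedBall_zero_iff.1
      (TopologicalSpace.denseSeq (Metric.closedBall (0 : E M) ε) _).2
  · intro n
    exact Nat.find_spec (hex n (w, x, y))

end LossLemmas

/-! ### Contraction by the combination matrix on vectors of zero average -/

section Mixing

variable {K : ℕ} {V : Type*} [NormedAddCommGroup V]
  {A B : Matrix (Fin K) (Fin K) ℝ} {π : Fin K → ℝ}

/-- The weighted square norm `∑ k, π k * ‖U k‖ ^ 2`. -/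
def wsq (π : Fin K → ℝ) (U : Fin K → V) : ℝ := ∑ k, π k * ‖U k‖ ^ 2

theorem wsq_nonneg (hπ : ∀ k, 0 ≤ π k) (U : Fin K → V) : 0 ≤ wsq π U :=
  Finset.sum_nonneg fun k _ => mul_nonneg (hπ k) (sq_nonneg _)

theorem norm_sub_sq_le (a b : V) {s : ℝ} (hs : 0 < s) :
    ‖a - b‖ ^ 2 ≤ (1 + s) * ‖a‖ ^ 2 + (1 + s⁻¹) * ‖b‖ ^ 2 := by
  have h1 : ‖a - b‖ ^ 2 ≤ (‖a‖ + ‖b‖) ^ 2 := by gcongr; exact norm_sub_le a b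
  have h2 : 0 ≤ s⁻¹ * (s * ‖a‖ - ‖b‖) ^ 2 := by positivity
  have h3 : s⁻¹ * (s * ‖a‖ - ‖b‖) ^ 2 = s * ‖a‖ ^ 2 - 2 * ‖a‖ * ‖b‖ + s⁻¹ * ‖b‖ ^ 2 := by
    field_simp; ring
  nlinarith

theorem wsq_sub_le (hπ : ∀ k, 0 ≤ π k) (U W : Fin K → V) {s : ℝ} (hs : 0 < s) :
    wsq π (U - W) ≤ (1 + s) * wsq π U + (1 + s⁻¹) * wsq π W := by
  unfold wsq
  rw [Finset.mul_sum, Finset.mul_sum, ← Finset.sum_add_distrib]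
  refine Finset.sum_le_sum fun k _ => ?_
  have := mul_le_mul_of_nonneg_left (norm_sub_sq_le (U k) (W k) hs) (hπ k)
  simp only [Pi.sub_apply]
  linarith

variable [NormedSpace ℝ V]

/-- One combination step: agent `k` receives `∑ l, A l k • U l`. -/
def mix (A : Matrix (Fin K) (Fin K) ℝ) (U : Fin K → V) : Fin K → V :=
  fun k => ∑ l, A l k • U l

/-- The average `∑ k, π k • U k`. -/
def wavg (π : Fin K → ℝ) (U : Fin K → V) : V := ∑ k, π k • U k

/-- A weighted sum of the square norms along `m` combination steps. -/
noncomputable def mixSq (A : Matrix (Fin K) (Fin K) ℝ) (π : Fin K → ℝ) (θ : ℝ) (m : ℕ)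
    (U : Fin K → V) : ℝ :=
  ∑ j ∈ Finset.range m, (θ ^ j)⁻¹ * wsq π ((mix A)^[j] U)

theorem norm_sum_smul_sq_le {ι : Type*} (s : Finset ι) {a : ι → ℝ} (ha : ∀ i ∈ s, 0 ≤ a i)
    (U : ι → V) : ‖∑ i ∈ s, a i • U i‖ ^ 2 ≤ (∑ i ∈ s, a i) * ∑ i ∈ s, a i * ‖U i‖ ^ 2 := by
  have h1 : ‖∑ i ∈ s, a i • U i‖ ≤ ∑ i ∈ s, a i * ‖U i‖ := by
    refine (norm_sum_le _ _).trans (Finset.sum_le_sum fun i hi => ?_)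
    rw [norm_smul, Real.norm_of_nonneg (ha i hi)]
  calc ‖∑ i ∈ s, a i • U i‖ ^ 2 ≤ (∑ i ∈ s, a i * ‖U i‖) ^ 2 := by gcongr
    _ ≤ _ := Finset.sum_sq_le_sum_mul_sum_of_sq_le_mul s ha
        (fun i hi => mul_nonneg (ha i hi) (sq_nonneg _)) fun i _ => by ring_nf; rfl

theorem norm_wavg_sq_le (hπ : IsPerronVector A π) (U : Fin K → V) :
    ‖wavg π U‖ ^ 2 ≤ wsq π U := by
  have := norm_sum_smul_sq_le Finset.univ (fun i _ => (hπ.pos i).le) U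
  rwa [hπ.sum_eq_one, one_mul] at this

theorem wsq_smul (c : ℝ) (U : Fin K → V) : wsq π (c • U) = c ^ 2 * wsq π U := by
  simp only [wsq, Pi.smul_apply, norm_smul, mul_pow, Real.norm_eq_abs, sq_abs, Finset.mul_sum]
  exact Finset.sum_congr rfl fun _ _ => by ring

theorem mix_sub (U W : Fin K → V) : mix A (U - W) = mix A U - mix A W := by
  ext k; simp [mix, smul_sub]

theorem mix_smul (c : ℝ) (U : Fin K → V) : mix A (c • U) = c • mix A U := by
  ext k; simp [mix, Finset.smul_sum, smul_comm c]

theorem mix_mix (U : Fin K → V) : mix A (mix B U) = mix (B * A) U := by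
  ext k
  simp only [mix, Finset.smul_sum, Matrix.mul_apply, Finset.sum_smul, smul_smul]
  rw [Finset.sum_comm]
  simp only [mul_comm]

theorem iterate_mix (j : ℕ) (U : Fin K → V) : (mix A)^[j] U = mix (A ^ j) U := by
  induction j with
  | zero => ext k; simp [mix, Matrix.one_apply]
  | succ j ih => rw [Function.iterate_succ_apply', ih, mix_mix, pow_succ]

theorem mix_const (hA : StronglyConnected A) (v : V) : mix A (fun _ => v) = fun _ => v := by
  ext k; simp [mix, ← Finset.sum_smul, hA.column_sum]

theorem wavg_mix (hπ : A.mulVec π = π) (U : Fin K → V) : wavg π (mix A U) = wavg π U := by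
  simp only [wavg, mix, Finset.smul_sum, smul_smul]
  rw [Finset.sum_comm]
  refine Finset.sum_congr rfl fun l _ => ?_
  rw [← Finset.sum_smul]
  congr 1
  conv_rhs => rw [← hπ]
  simp [Matrix.mulVec, dotProduct, mul_comm]

/-- Cauchy–Schwarz in each column gives one factor `s`; summing against `π` and using the
eigenvector equation gives the other. -/
theorem wsq_mix_le (hπ : ∀ k, 0 ≤ π k) {s : ℝ} (hB : ∀ l k, 0 ≤ B l k)
    (hcol : ∀ k, ∑ l, B l k = s) (hBπ : B.mulVec π = s • π) (U : Fin K → V) :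
    wsq π (mix B U) ≤ s ^ 2 * wsq π U := by
  have h1 : wsq π (mix B U) ≤ ∑ k, π k * (s * ∑ l, B l k * ‖U l‖ ^ 2) := by
    refine Finset.sum_le_sum fun k _ => mul_le_mul_of_nonneg_left ?_ (hπ k)
    have := norm_sum_smul_sq_le Finset.univ (fun l _ => hB l k) U
    rwa [hcol] at this
  refine h1.trans_eq ?_
  have h2 : ∀ l, ∑ k, B l k * π k = s * π l := fun l => congrFun hBπ l
  simp only [Finset.mul_sum]
  rw [Finset.sum_comm, wsq, Finset.mul_sum]
  refine Finset.sum_congr rfl fun l _ => ?_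
  calc _ = s * ‖U l‖ ^ 2 * ∑ k, B l k * π k := by
        rw [Finset.mul_sum]; exact Finset.sum_congr rfl fun _ _ => by ring
    _ = _ := by rw [h2]; ring

theorem pow_nonneg_entries (hA : ∀ l k, 0 ≤ A l k) (j : ℕ) : ∀ l k, 0 ≤ (A ^ j) l k :=
  fun l k => Matrix.pow_apply_nonneg hA j l k

theorem pow_column_sum (hA : ∀ k, ∑ l, A l k = 1) (j : ℕ) (k : Fin K) :
    ∑ l, (A ^ j) l k = 1 := by
  induction j generalizing k with
  | zero => simp [Matrix.one_apply]
  | succ j ih =>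
    simp only [pow_succ, Matrix.mul_apply]
    rw [Finset.sum_comm]
    simp [← Finset.sum_mul, ih, hA]

theorem pow_mulVec_eq (hπ : A.mulVec π = π) (j : ℕ) : (A ^ j).mulVec π = π := by
  induction j with
  | zero => simp
  | succ j ih => rw [pow_succ, ← Matrix.mulVec_mulVec, hπ, ih]

theorem pow_add_pos (hA : ∀ l k, 0 ≤ A l k) {i j : ℕ} {a b c : Fin K} (h₁ : 0 < (A ^ i) a b)
    (h₂ : 0 < (A ^ j) b c) : 0 < (A ^ (i + j)) a c := by
  rw [pow_add, Matrix.mul_apply]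
  exact Finset.sum_pos' (fun l _ => mul_nonneg (pow_nonneg_entries hA i a l)
    (pow_nonneg_entries hA j l c)) ⟨b, Finset.mem_univ b, mul_pos h₁ h₂⟩

/-- The combination matrix is primitive. -/
theorem StronglyConnected.exists_pow_pos (hA : StronglyConnected A) :
    ∃ m : ℕ, 0 < m ∧ ∀ l k, 0 < (A ^ m) l k := by
  have hreach : ∀ l k, ∃ n : ℕ, 0 < (A ^ n) l k := by
    intro l k
    induction hA.path l k with
    | refl => exact ⟨0, by simp⟩
    | @tail b c _ hbc ih =>
      obtain ⟨n, hn⟩ := ih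
      exact ⟨n + 1, pow_add_pos hA.nonneg hn
        (by simpa using lt_of_le_of_ne (hA.nonneg b c) (Ne.symm hbc))⟩
  choose f hf using hreach
  obtain ⟨k₀, hk₀⟩ := hA.self_loop
  have hloop : ∀ n : ℕ, 0 < (A ^ n) k₀ k₀ := by
    intro n
    induction n with
    | zero => simp
    | succ n ih => exact pow_add_pos hA.nonneg ih (by simpa using hk₀)
  -- One exponent serves all pairs: travel through `k₀` and spend the remaining steps on its
  -- self-loop.
  refine ⟨(∑ l, f l k₀) + (∑ k, f k₀ k) + 1, by omega, fun l k => ?_⟩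
  have h1 : f l k₀ ≤ ∑ l, f l k₀ :=
    Finset.single_le_sum (f := fun l => f l k₀) (fun _ _ => Nat.zero_le _) (Finset.mem_univ l)
  have h2 : f k₀ k ≤ ∑ k, f k₀ k :=
    Finset.single_le_sum (f := fun k => f k₀ k) (fun _ _ => Nat.zero_le _) (Finset.mem_univ k)
  obtain ⟨r, hr⟩ : ∃ r, (∑ l, f l k₀) + (∑ k, f k₀ k) + 1 = f l k₀ + r + f k₀ k :=
    ⟨(∑ l, f l k₀) + (∑ k, f k₀ k) + 1 - f l k₀ - f k₀ k, by omega⟩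
  rw [hr]
  exact pow_add_pos hA.nonneg (pow_add_pos hA.nonneg (hf l k₀) (hloop r)) (hf k₀ k)

/-- Some power of a combination matrix is a strict contraction on vectors of zero average. -/
theorem StronglyConnected.exists_wsq_contraction (hA : StronglyConnected A)
    (hπ : IsPerronVector A π) : ∃ m : ℕ, 0 < m ∧ ∃ η : ℝ, 0 < η ∧ η < 1 ∧
      ∀ U : Fin K → V, wavg π U = 0 → wsq π ((mix A)^[m] U) ≤ (1 - η) ^ 2 * wsq π U := by
  obtain ⟨m, hm, hpos⟩ := hA.exists_pow_pos
  obtain ⟨k₀, -⟩ := hA.self_loop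
  have : Nonempty (Fin K) := ⟨k₀⟩
  obtain ⟨p, hp⟩ := Finite.exists_min fun p : Fin K × Fin K => (A ^ m) p.1 p.2
  -- The cap `1 / 2` keeps `η < 1`, for instance when there is a single agent.
  set η := min ((A ^ m) p.1 p.2) (1 / 2) with hη
  have hη0 : 0 < η := lt_min (hpos _ _) (by norm_num)
  have hη1 : η < 1 := (min_le_right _ _).trans_lt (by norm_num)
  refine ⟨m, hm, η, hη0, hη1, fun U hU => ?_⟩
  -- Doeblin minorization: the rank-one part removed vanishes on vectors of zero average, and the
  -- remainder is nonnegative with column sums and eigenvalue `1 - η`.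
  set R : Matrix (Fin K) (Fin K) ℝ := fun l k => (A ^ m) l k - η * π l with hR
  have hπ1 : ∀ l, π l ≤ 1 := fun l => hπ.sum_eq_one ▸
    Finset.single_le_sum (f := π) (fun i _ => (hπ.pos i).le) (Finset.mem_univ l)
  have hmix : mix (A ^ m) U = mix R U := by
    ext k
    simp only [mix, hR, sub_smul, Finset.sum_sub_distrib, mul_smul, ← Finset.smul_sum]
    have : ∑ l, π l • U l = 0 := hU
    simp [this]
  rw [iterate_mix, hmix]
  refine wsq_mix_le (fun k => (hπ.pos k).le) (fun l k => ?_) (fun k => ?_) ?_ U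
  · have h1 : η ≤ (A ^ m) l k := (min_le_left _ _).trans (hp (l, k))
    have h2 : η * π l ≤ η * 1 := mul_le_mul_of_nonneg_left (hπ1 l) hη0.le
    simp only [hR]
    linarith
  · simp [hR, Finset.sum_sub_distrib, ← Finset.mul_sum, hπ.sum_eq_one,
      pow_column_sum hA.column_sum]
  · ext l
    have h1 : ∑ k, (A ^ m) l k * π k = π l := congrFun (pow_mulVec_eq hπ.eigen m) l
    simp only [Matrix.mulVec, dotProduct, hR, sub_mul, Finset.sum_sub_distrib, h1,
      ← Finset.mul_sum, hπ.sum_eq_one, Pi.smul_apply, smul_eq_mul]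
    ring

theorem mixSq_le_of_wsq_le {θ s t : ℝ} {m : ℕ} (hθ : 0 < θ) {X Y Z : Fin K → V}
    (h : ∀ j, wsq π ((mix A)^[j] X) ≤ s * wsq π ((mix A)^[j] Y) + t * wsq π ((mix A)^[j] Z)) :
    mixSq A π θ m X ≤ s * mixSq A π θ m Y + t * mixSq A π θ m Z := by
  unfold mixSq
  rw [Finset.mul_sum, Finset.mul_sum, ← Finset.sum_add_distrib]
  refine Finset.sum_le_sum fun j _ => ?_
  have : 0 ≤ (θ ^ j)⁻¹ := by positivity
  have := mul_le_mul_of_nonneg_left (h j) this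
  linarith

theorem mixSq_sub_le (hπ : ∀ k, 0 ≤ π k) {θ : ℝ} (hθ : 0 < θ) (m : ℕ) (U W : Fin K → V)
    {s : ℝ} (hs : 0 < s) :
    mixSq A π θ m (U - W) ≤ (1 + s) * mixSq A π θ m U + (1 + s⁻¹) * mixSq A π θ m W := by
  refine mixSq_le_of_wsq_le hθ fun j => ?_
  simp only [iterate_mix, mix_sub]
  exact wsq_sub_le hπ _ _ hs

theorem mixSq_smul (θ : ℝ) (m : ℕ) (c : ℝ) (U : Fin K → V) :
    mixSq A π θ m (c • U) = c ^ 2 * mixSq A π θ m U := by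
  simp only [mixSq, iterate_mix, mix_smul, wsq_smul, Finset.mul_sum]
  exact Finset.sum_congr rfl fun _ _ => by ring

theorem mixSq_le (hA : StronglyConnected A) (hπ : IsPerronVector A π) {θ : ℝ} (hθ : 0 < θ)
    (m : ℕ) (U : Fin K → V) :
    mixSq A π θ m U ≤ (∑ j ∈ Finset.range m, (θ ^ j)⁻¹) * wsq π U := by
  unfold mixSq
  rw [Finset.sum_mul]
  refine Finset.sum_le_sum fun j _ => mul_le_mul_of_nonneg_left ?_ (by positivity)
  rw [iterate_mix]
  have := wsq_mix_le (fun k => (hπ.pos k).le) (s := 1) (pow_nonneg_entries hA.nonneg j)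
    (pow_column_sum hA.column_sum j) (by rw [pow_mulVec_eq hπ.eigen, one_smul]) U
  simpa using this

theorem wsq_le_mixSq (hπ : ∀ k, 0 ≤ π k) {θ : ℝ} (hθ : 0 < θ) {m : ℕ} (hm : 0 < m)
    (U : Fin K → V) : wsq π U ≤ mixSq A π θ m U := by
  have := Finset.single_le_sum (f := fun j => (θ ^ j)⁻¹ * wsq π ((mix A)^[j] U))
    (fun j _ => mul_nonneg (by positivity) (wsq_nonneg hπ _)) (Finset.mem_range.2 hm)
  simpa [mixSq] using this

/-- The weights `(θ ^ j)⁻¹` turn a contraction by the `m`-th power into one by a single step: mixing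
shifts the sum by one index at the price of `θ`, and the new last term is dominated by the lost
first term. -/
theorem mixSq_mix_le {θ : ℝ} (hθ : 0 < θ) {m : ℕ} (hm : 0 < m) {U : Fin K → V}
    (hU : wsq π ((mix A)^[m] U) ≤ θ ^ m * wsq π U) :
    mixSq A π θ m (mix A U) ≤ θ * mixSq A π θ m U := by
  obtain ⟨m, rfl⟩ : ∃ r, m = r + 1 := ⟨m - 1, by omega⟩
  have h1 : mixSq A π θ (m + 1) (mix A U)
      = θ * ∑ j ∈ Finset.range (m + 1), (θ ^ (j + 1))⁻¹ * wsq π ((mix A)^[j + 1] U) := by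
    rw [mixSq, Finset.mul_sum]
    refine Finset.sum_congr rfl fun j _ => ?_
    rw [Function.iterate_succ_apply, pow_succ]
    field_simp
  rw [h1]
  refine mul_le_mul_of_nonneg_left ?_ hθ.le
  rw [mixSq, Finset.sum_range_succ, Finset.sum_range_succ']
  have h2 : (θ ^ (m + 1))⁻¹ * wsq π ((mix A)^[m + 1] U)
      ≤ (θ ^ (m + 1))⁻¹ * (θ ^ (m + 1) * wsq π U) :=
    mul_le_mul_of_nonneg_left hU (by positivity)
  rw [inv_mul_cancel_left₀ (by positivity)] at h2
  simpa using h2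

/-- A combination matrix contracts a quadratic form equivalent to the weighted square norm. -/
theorem StronglyConnected.exists_mixSq_contraction (hA : StronglyConnected A)
    (hπ : IsPerronVector A π) : ∃ m : ℕ, 0 < m ∧ ∃ θ : ℝ, 0 < θ ∧ θ < 1 ∧
      ∀ U : Fin K → V, wavg π U = 0 → mixSq A π θ m (mix A U) ≤ θ * mixSq A π θ m U := by
  obtain ⟨m, hm, η, hη0, hη1, h⟩ := hA.exists_wsq_contraction (V := V) hπ
  have hm' : (1 : ℝ) ≤ m := by exact_mod_cast hm
  have hdiv : η / m ≤ η := div_le_self hη0.le hm'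
  have hdiv0 : 0 < η / m := by positivity
  refine ⟨m, hm, 1 - η / m, by linarith, by linarith, fun U hU => ?_⟩
  refine mixSq_mix_le (by linarith) hm ((h U hU).trans ?_)
  refine mul_le_mul_of_nonneg_right ?_ (wsq_nonneg (fun k => (hπ.pos k).le) U)
  -- Bernoulli's inequality shows that the explicit rate `1 - η / m` is slow enough for its `m`-th
  -- power to exceed `(1 - η) ^ 2`, which avoids taking roots.
  have hb := one_add_mul_le_pow (a := -(η / m)) (by linarith) m
  have : (m : ℝ) * -(η / m) = -η := by field_simp
  rw [this] at hb
  have h3 : (1 - η) ^ 2 ≤ 1 - η := by nlinarith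
  calc (1 - η) ^ 2 ≤ 1 + -η := by linarith
    _ ≤ (1 + -(η / m)) ^ m := hb
    _ = _ := by ring

end Mixing

/-! ### Adversarial risk: quadratic growth and independence from a fresh sample -/

section Risk

variable {M : ℕ} {q : Loss M} {ε ν L₁ L₂ L₃ L₄ L₅ : ℝ} {D : Measure (E M × ℝ)}

theorem advRisk_midpoint [IsProbabilityMeasure D] (hε : 0 ≤ ε) (hr : RegularLoss q ε D)
    (hc : StronglyConvexLoss q ν) (hs : SmoothLoss q ε L₁ L₂ L₃ L₄ L₅) (v w : E M) :
    2 * advRisk q ε D ((1 / 2 : ℝ) • (v + w)) + ν / 4 * ‖w - v‖ ^ 2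
      ≤ advRisk q ε D v + advRisk q ε D w := by
  unfold advRisk
  have h1 := ((hr.integrable_advLoss ((1 / 2 : ℝ) • (v + w))).const_mul 2).add
    (integrable_const (ν / 4 * ‖w - v‖ ^ 2))
  have h2 := integral_mono h1 ((hr.integrable_advLoss v).add (hr.integrable_advLoss w))
    fun z => advLoss_midpoint hε hc hs v w z.1 z.2
  simp only [Pi.add_apply] at h2
  rw [integral_add ((hr.integrable_advLoss _).const_mul 2) (integrable_const _),
    integral_add (hr.integrable_advLoss v) (hr.integrable_advLoss w), integral_const_mul] at h2
  simpa using h2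

/-- Midpoint strong convexity compared with minimality at the midpoint. This avoids differentiating
the risk; the constant `ν / 4` instead of `ν / 2` is harmless. -/
theorem quadratic_growth_aggRisk [IsProbabilityMeasure D] {K : ℕ} {Q : Fin K → Loss M}
    {A : Matrix (Fin K) (Fin K) ℝ} {π : Fin K → ℝ} (hπ : IsPerronVector A π) (hε : 0 ≤ ε)
    (hr : ∀ k, RegularLoss (Q k) ε D) (hc : ∀ k, StronglyConvexLoss (Q k) ν)
    (hs : ∀ k, SmoothLoss (Q k) ε L₁ L₂ L₃ L₄ L₅) {wstar : E M}
    (hmin : ∀ w, aggRisk Q ε D π wstar ≤ aggRisk Q ε D π w) (w : E M) :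
    ν / 4 * ‖w - wstar‖ ^ 2 ≤ ∑ k, π k * (advRisk (Q k) ε D w - advRisk (Q k) ε D wstar) := by
  have h := hmin ((1 / 2 : ℝ) • (wstar + w))
  have h1 : ∑ k, π k * (2 * advRisk (Q k) ε D ((1 / 2 : ℝ) • (wstar + w))
      + ν / 4 * ‖w - wstar‖ ^ 2)
      ≤ ∑ k, π k * (advRisk (Q k) ε D wstar + advRisk (Q k) ε D w) :=
    Finset.sum_le_sum fun k _ => mul_le_mul_of_nonneg_left
      (advRisk_midpoint hε (hr k) (hc k) (hs k) wstar w) (hπ.pos k).le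
  have h2 : ∑ k, π k * (2 * advRisk (Q k) ε D ((1 / 2 : ℝ) • (wstar + w))
      + ν / 4 * ‖w - wstar‖ ^ 2) = 2 * aggRisk Q ε D π ((1 / 2 : ℝ) • (wstar + w))
      + ν / 4 * ‖w - wstar‖ ^ 2 := by
    simp only [mul_add, Finset.sum_add_distrib, ← Finset.sum_mul, hπ.sum_eq_one, one_mul, aggRisk,
      Finset.mul_sum]
    congr 1
    exact Finset.sum_congr rfl fun _ _ => by ring
  have h3 : ∑ k, π k * (advRisk (Q k) ε D wstar + advRisk (Q k) ε D w)
      = aggRisk Q ε D π wstar + aggRisk Q ε D π w := by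
    simp only [mul_add, Finset.sum_add_distrib, aggRisk]
  have h4 : ∑ k, π k * (advRisk (Q k) ε D w - advRisk (Q k) ε D wstar)
      = aggRisk Q ε D π w - aggRisk Q ε D π wstar := by
    simp only [mul_sub, Finset.sum_sub_distrib, aggRisk]
  linarith

/-- The norm of the stochastic gradient at `v`, enlarged so as to cover all perturbations. -/
noncomputable def gradBound (q : Loss M) (ε L : ℝ) (v : E M) (z : E M × ℝ) : ℝ :=
  ‖gradW q v z.1 z.2‖ + |L| * ε

theorem RegularLoss.memLp_gradBound [IsProbabilityMeasure D] (hr : RegularLoss q ε D) (L : ℝ)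
    (v : E M) : MemLp (gradBound q ε L v) 2 D :=
  (hr.memLp_gradW v).norm.add (memLp_const _)

/-- Subgradient inequalities at `w` and at `v` bound the difference from both sides. The bound is
integrable when `w` is a square-integrable random model. -/
theorem abs_advLoss_sub_le (hε : 0 ≤ ε) (hν : 0 ≤ ν) (hc : StronglyConvexLoss q ν)
    (hs : SmoothLoss q ε L₁ L₂ L₃ L₄ L₅) (v w : E M) (z : E M × ℝ) :
    |advLoss q ε w z.1 z.2 - advLoss q ε v z.1 z.2|
      ≤ gradBound q ε L₂ v z * ‖w - v‖ + |L₁| * ‖w - v‖ ^ 2 := by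
  obtain ⟨d, hd⟩ := hs.exists_isWorstCase hε w z.1 z.2
  obtain ⟨e, he⟩ := hs.exists_isWorstCase hε v z.1 z.2
  have h1 := hd.advLoss_add_inner_le hc hs v
  have h2 := he.advLoss_add_inner_le hc hs w
  have h3 := hs.norm_gradW_le v w z.1 z.2 hd.1
  have h4 := hs.norm_gradW_le v v z.1 z.2 he.1
  rw [sub_self, norm_zero, mul_zero, add_zero] at h4
  change _ ≤ gradBound q ε L₂ v z + _ at h3
  change _ ≤ gradBound q ε L₂ v z at h4
  have h5 := (abs_le.1 (abs_real_inner_le_norm (gradW q w (z.1 + d) z.2) (v - w))).1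
  have h6 := (abs_le.1 (abs_real_inner_le_norm (gradW q v (z.1 + e) z.2) (w - v))).1
  have h7 := mul_le_mul_of_nonneg_right h3 (norm_nonneg (w - v))
  have h8 := mul_le_mul_of_nonneg_right h4 (norm_nonneg (w - v))
  have h9 : 0 ≤ ν / 2 * ‖w - v‖ ^ 2 := by positivity
  have h10 : 0 ≤ |L₁| * ‖w - v‖ ^ 2 := by positivity
  rw [norm_sub_rev v w] at h1 h5
  rw [abs_le]
  constructor <;> nlinarith

variable {Ω : Type*} [MeasurableSpace Ω] {P : Measure Ω} {c : Ω → E M} {z : Ω → E M × ℝ}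

theorem memLp_comp_of_map_eq {F : Type*} [NormedAddCommGroup F] {f : E M × ℝ → F}
    (hz : Measurable z) (hlaw : P.map z = D) (hf : MemLp f 2 D) : MemLp (fun ω => f (z ω)) 2 P := by
  subst hlaw
  exact hf.comp_of_map hz.aemeasurable

theorem integrable_advLoss_sub [IsProbabilityMeasure P] [IsProbabilityMeasure D] (hε : 0 ≤ ε)
    (hν : 0 ≤ ν) (hr : RegularLoss q ε D)
    (hc : StronglyConvexLoss q ν) (hs : SmoothLoss q ε L₁ L₂ L₃ L₄ L₅) (v : E M)
    (hz : Measurable z) (hlaw : P.map z = D) (hcL : MemLp c 2 P) :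
    Integrable (fun ω => advLoss q ε (c ω) (z ω).1 (z ω).2 - advLoss q ε v (z ω).1 (z ω).2) P := by
  have hd : MemLp (fun ω => ‖c ω - v‖) 2 P := (hcL.sub (memLp_const v)).norm
  have hg : MemLp (fun ω => gradBound q ε L₂ v (z ω)) 2 P :=
    memLp_comp_of_map_eq hz hlaw (hr.memLp_gradBound L₂ v)
  refine ((hg.integrable_mul hd).add (hd.integrable_sq.const_mul |L₁|)).mono' ?_ ?_
  · have hm := hr.measurable_advLoss hε hs
    have h1 : AEMeasurable (fun ω => (c ω, z ω)) P :=
      hcL.aestronglyMeasurable.aemeasurable.prodMk hz.aemeasurable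
    have h2 : AEMeasurable (fun ω => (v, z ω)) P := aemeasurable_const.prodMk hz.aemeasurable
    exact ((hm.comp_aemeasurable h1).sub (hm.comp_aemeasurable h2)).aestronglyMeasurable
  · exact Eventually.of_forall fun ω => abs_advLoss_sub_le hε hν hc hs v (c ω) (z ω)

/-- The expected excess adversarial loss at a model independent of the sample is the expected
excess risk. -/
theorem integral_advLoss_sub [IsProbabilityMeasure P] [IsProbabilityMeasure D] (hε : 0 ≤ ε)
    (hν : 0 ≤ ν) (hr : RegularLoss q ε D)
    (hc : StronglyConvexLoss q ν) (hs : SmoothLoss q ε L₁ L₂ L₃ L₄ L₅) (v : E M)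
    (hz : Measurable z) (hlaw : P.map z = D) (hcL : MemLp c 2 P) (hind : IndepFun c z P) :
    Integrable (fun ω => advRisk q ε D (c ω) - advRisk q ε D v) P ∧
    ∫ ω, (advLoss q ε (c ω) (z ω).1 (z ω).2 - advLoss q ε v (z ω).1 (z ω).2) ∂P
      = ∫ ω, (advRisk q ε D (c ω) - advRisk q ε D v) ∂P := by
  set G : E M × (E M × ℝ) → ℝ :=
    fun p => advLoss q ε p.1 p.2.1 p.2.2 - advLoss q ε v p.2.1 p.2.2 with hG
  have hm := hr.measurable_advLoss hε hs
  have hGm : Measurable G := hm.sub (hm.comp (measurable_const.prodMk measurable_snd))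
  have hca : AEMeasurable c P := hcL.aestronglyMeasurable.aemeasurable
  have hcz : AEMeasurable (fun ω => (c ω, z ω)) P := hca.prodMk hz.aemeasurable
  have hmap : P.map (fun ω => (c ω, z ω)) = (P.map c).prod D := by
    rw [← hlaw]
    exact (indepFun_iff_map_prod_eq_prod_map_map hca hz.aemeasurable).1 hind
  have : IsProbabilityMeasure (P.map c) := Measure.isProbabilityMeasure_map hca
  have hint : Integrable G ((P.map c).prod D) := by
    rw [← hmap, integrable_map_measure hGm.aestronglyMeasurable hcz]
    exact integrable_advLoss_sub hε hν hr hc hs v hz hlaw hcL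
  have hinner : ∀ u, ∫ z, G (u, z) ∂D = advRisk q ε D u - advRisk q ε D v := fun u =>
    integral_sub (hr.integrable_advLoss u) (hr.integrable_advLoss v)
  have h1 := hint.integral_prod_left
  simp only [hinner] at h1
  refine ⟨h1.comp_aemeasurable hca, ?_⟩
  calc _ = ∫ p, G p ∂(P.map (fun ω => (c ω, z ω))) :=
        (integral_map hcz hGm.aestronglyMeasurable).symm
    _ = ∫ u, (advRisk q ε D u - advRisk q ε D v) ∂(P.map c) := by
        rw [hmap, integral_prod _ hint]
        simp only [hinner]
    _ = _ := integral_map hca h1.aestronglyMeasurable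

end Risk

/-! ### Independence of the past from the next sample -/

section History

variable {K M : ℕ} {Ω : Type*} [MeasurableSpace Ω] {P : Measure Ω}
  {D : Measure (E M × ℝ)} {ξ : ℕ → Fin K → Ω → E M × ℝ} {w₀ : Fin K → Ω → E M}

/-- Both hypotheses together make the law of `(f, (g, h))` a triple product, which is then
reassociated. -/
theorem IndepFun.prodMk_left_of_prodMk_right {α β γ : Type*} [MeasurableSpace α]
    [MeasurableSpace β] [MeasurableSpace γ] [IsProbabilityMeasure P] {f : Ω → α} {g : Ω → β} {h : Ω → γ}
    (hf : Measurable f) (hg : Measurable g) (hh : Measurable h)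
    (h₁ : IndepFun f (fun ω => (g ω, h ω)) P) (h₂ : IndepFun g h P) :
    IndepFun (fun ω => (f ω, g ω)) h P := by
  have hfg : IndepFun f g P := h₁.comp measurable_id measurable_fst
  have := Measure.isProbabilityMeasure_map hf.aemeasurable (μ := P)
  have := Measure.isProbabilityMeasure_map hg.aemeasurable (μ := P)
  have := Measure.isProbabilityMeasure_map hh.aemeasurable (μ := P)
  rw [indepFun_iff_map_prod_eq_prod_map_map (hf.prodMk hg).aemeasurable hh.aemeasurable,
    (indepFun_iff_map_prod_eq_prod_map_map hf.aemeasurable hg.aemeasurable).1 hfg]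
  have e1 := (indepFun_iff_map_prod_eq_prod_map_map hf.aemeasurable
    (hg.prodMk hh).aemeasurable).1 h₁
  rw [(indepFun_iff_map_prod_eq_prod_map_map hg.aemeasurable hh.aemeasurable).1 h₂] at e1
  have e2 := congrArg (Measure.map (MeasurableEquiv.prodAssoc (α := α) (β := β) (γ := γ)).symm) e1
  rw [Measure.map_map (MeasurableEquiv.measurable _) (hf.prodMk (hg.prodMk hh))] at e2
  refine e2.trans ?_
  rw [← Measure.prodAssoc_prod, MeasurableEquiv.map_symm_map]

/-- The initial models together with the samples of the first `n` steps. -/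
def history (w₀ : Fin K → Ω → E M) (ξ : ℕ → Fin K → Ω → E M × ℝ) (n : ℕ) (ω : Ω) :
    (Fin K → E M) × (↥(Finset.range n ×ˢ (Finset.univ : Finset (Fin K))) → E M × ℝ) :=
  (fun k => w₀ k ω, fun p => ξ p.1.1 p.1.2 ω)

theorem measurable_history (hξ : IIDSamples ξ D P) (hw : AdmissibleInit w₀ ξ P) (n : ℕ) :
    Measurable (history w₀ ξ n) :=
  (measurable_pi_lambda _ hw.measurable).prodMk
    (measurable_pi_lambda _ fun p => hξ.measurable p.1.1 p.1.2)

theorem indepFun_history [IsProbabilityMeasure P] (hξ : IIDSamples ξ D P) (hw : AdmissibleInit w₀ ξ P) (n : ℕ)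
    (k : Fin K) : IndepFun (history w₀ ξ n) (ξ n k) P := by
  have hm : ∀ p : ℕ × Fin K, Measurable (ξ p.1 p.2) := fun p => hξ.measurable p.1 p.2
  have hdisj : Disjoint (Finset.range n ×ˢ (Finset.univ : Finset (Fin K))) {(n, k)} := by
    rw [Finset.disjoint_singleton_right]; simp
  have h1 := (hξ.indep.indepFun_finset _ _ hdisj hm).comp measurable_id
    (measurable_pi_apply (⟨(n, k), Finset.mem_singleton_self _⟩ : ({(n, k)} : Finset (ℕ × Fin K))))
  have h2 := hw.indep.comp (φ := id)
    (ψ := fun s : ℕ × Fin K → E M × ℝ =>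
      ((fun p : ↥(Finset.range n ×ˢ (Finset.univ : Finset (Fin K))) => s p.1), s (n, k)))
    measurable_id (by fun_prop)
  exact IndepFun.prodMk_left_of_prodMk_right (measurable_pi_lambda _ hw.measurable)
    (measurable_pi_lambda _ fun p => hξ.measurable p.1.1 p.1.2) (hξ.measurable n k) h2 h1

end History

/-! ### Pathwise estimates for one adapt-then-combine step -/

section OneStep

variable {M : ℕ} {q : Loss M} {ε ν L₁ L₂ L₃ L₄ L₅ : ℝ}

theorem IsWorstCase.norm_gradW_sq_le (hs : SmoothLoss q ε L₁ L₂ L₃ L₄ L₅)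
    {w δ : E M} {z : E M × ℝ} (h : IsWorstCase q ε w z.1 z.2 δ) (c v : E M) :
    ‖gradW q w (z.1 + δ) z.2‖ ^ 2
      ≤ 3 * (gradBound q ε L₂ v z ^ 2 + L₁ ^ 2 * ‖c - v‖ ^ 2 + L₁ ^ 2 * ‖w - c‖ ^ 2) := by
  have h1 := hs.norm_gradW_le v w z.1 z.2 h.1
  change _ ≤ gradBound q ε L₂ v z + _ at h1
  have h2 : ‖w - v‖ ≤ ‖w - c‖ + ‖c - v‖ := norm_sub_le_norm_sub_add_norm_sub w c v
  have h3 : ‖gradW q w (z.1 + δ) z.2‖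
      ≤ gradBound q ε L₂ v z + |L₁| * ‖w - c‖ + |L₁| * ‖c - v‖ := by
    have := mul_le_mul_of_nonneg_left h2 (abs_nonneg L₁)
    linarith
  have h4 : ‖gradW q w (z.1 + δ) z.2‖ ^ 2
      ≤ (gradBound q ε L₂ v z + |L₁| * ‖w - c‖ + |L₁| * ‖c - v‖) ^ 2 := by gcongr
  rw [← sq_abs L₁]
  nlinarith [sq_nonneg (gradBound q ε L₂ v z - |L₁| * ‖w - c‖),
    sq_nonneg (gradBound q ε L₂ v z - |L₁| * ‖c - v‖),
    sq_nonneg (|L₁| * ‖w - c‖ - |L₁| * ‖c - v‖)]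

/-- Correlation of an adversarial gradient at `w` with the direction from `v` to `c`. -/
theorem IsWorstCase.advLoss_sub_le_inner (hε : 0 ≤ ε) (hν : 0 ≤ ν)
    (hc : StronglyConvexLoss q ν) (hs : SmoothLoss q ε L₁ L₂ L₃ L₄ L₅)
    {w δ : E M} {z : E M × ℝ} (h : IsWorstCase q ε w z.1 z.2 δ) (c v : E M) :
    advLoss q ε c z.1 z.2 - advLoss q ε v z.1 z.2
        - (2 * gradBound q ε L₂ v z + 2 * |L₁| * ‖c - v‖ + |L₁| * ‖w - c‖) * ‖w - c‖
      ≤ inner ℝ (gradW q w (z.1 + δ) z.2) (c - v) := by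
  obtain ⟨e, he⟩ := hs.exists_isWorstCase hε c z.1 z.2
  set g := gradW q w (z.1 + δ) z.2 with hg
  set g' := gradW q c (z.1 + e) z.2 with hg'
  -- Adding the inequalities from `w` to `v` and from `c` to `w` eliminates the loss at `w`. The
  -- gradients `g` and `g'` may belong to distant perturbations, so only their norms enter the
  -- error.
  have h1 := h.advLoss_add_inner_le hc hs v
  have h2 := he.advLoss_add_inner_le hc hs w
  have h3 := hs.norm_gradW_le v w z.1 z.2 h.1
  have h4 := hs.norm_gradW_le v c z.1 z.2 he.1
  change ‖g‖ ≤ gradBound q ε L₂ v z + _ at h3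
  change ‖g'‖ ≤ gradBound q ε L₂ v z + _ at h4
  have h5 : ‖w - v‖ ≤ ‖w - c‖ + ‖c - v‖ := norm_sub_le_norm_sub_add_norm_sub w c v
  have h6 := mul_le_mul_of_nonneg_left h5 (abs_nonneg L₁)
  have h7 := (abs_le.1 (abs_real_inner_le_norm g' (w - c))).1
  have h8 := (abs_le.1 (abs_real_inner_le_norm g (w - c))).2
  have h9 : (‖g‖ + ‖g'‖) * ‖w - c‖
      ≤ (2 * gradBound q ε L₂ v z + 2 * |L₁| * ‖c - v‖ + |L₁| * ‖w - c‖) * ‖w - c‖ := by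
    exact mul_le_mul_of_nonneg_right (by linarith) (norm_nonneg _)
  have h10 : inner ℝ g (c - v) = - inner ℝ g (v - w) - inner ℝ g (w - c) := by
    rw [← inner_neg_right, ← inner_sub_right]
    congr 1
    abel
  have h11 : 0 ≤ ν / 2 * ‖v - w‖ ^ 2 := by positivity
  have h12 : 0 ≤ ν / 2 * ‖w - c‖ ^ 2 := by positivity
  rw [h10]
  linarith

/-- Young's inequality is balanced so that the sample term carries `μ ^ 2`, the centroid term uses
half of the decrease `2 * μ * (ν / 4)` due to quadratic growth, and the rest falls on the deviation
`w - c`. The deviation coefficient need not be small, since the deviation is itself driven at order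
`μ ^ 2`. -/
theorem IsWorstCase.neg_inner_le (hε : 0 ≤ ε) (hν : 0 < ν)
    (hc : StronglyConvexLoss q ν) (hs : SmoothLoss q ε L₁ L₂ L₃ L₄ L₅) {μ : ℝ} (hμ : 0 ≤ μ)
    {w δ : E M} {z : E M × ℝ} (h : IsWorstCase q ε w z.1 z.2 δ) (c v : E M) :
    -(2 * μ) * inner ℝ (gradW q w (z.1 + δ) z.2) (c - v)
      ≤ -(2 * μ) * (advLoss q ε c z.1 z.2 - advLoss q ε v z.1 z.2)
        + 2 * μ ^ 2 * gradBound q ε L₂ v z ^ 2 + μ * (ν / 4) * ‖c - v‖ ^ 2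
        + (2 + μ * (16 * L₁ ^ 2 / ν + 2 * |L₁|)) * ‖w - c‖ ^ 2 := by
  have h1 := mul_le_mul_of_nonneg_left (h.advLoss_sub_le_inner hε hν.le hc hs c v)
    (by positivity : 0 ≤ 2 * μ)
  have h2 : 4 * |L₁| * ‖c - v‖ * ‖w - c‖
      ≤ ν / 4 * ‖c - v‖ ^ 2 + 16 * L₁ ^ 2 / ν * ‖w - c‖ ^ 2 := by
    have h3 : 0 ≤ ν / 4 * (‖c - v‖ - 8 * |L₁| / ν * ‖w - c‖) ^ 2 := by positivity
    have h4 : ν / 4 * (‖c - v‖ - 8 * |L₁| / ν * ‖w - c‖) ^ 2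
        = ν / 4 * ‖c - v‖ ^ 2 - 4 * |L₁| * ‖c - v‖ * ‖w - c‖
          + 16 * L₁ ^ 2 / ν * ‖w - c‖ ^ 2 := by
      rw [← sq_abs L₁]; field_simp; ring
    linarith
  have h5 := mul_le_mul_of_nonneg_left h2 hμ
  nlinarith [sq_nonneg (μ * gradBound q ε L₂ v z - ‖w - c‖)]

variable {K : ℕ} {A : Matrix (Fin K) (Fin K) ℝ} {π : Fin K → ℝ} {Q : Fin K → Loss M}
  {w δ : Fin K → E M} {z : Fin K → E M × ℝ}

/-- The stochastic gradients at the worst-case perturbations. -/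
noncomputable def advGrad (Q : Fin K → Loss M) (w δ : Fin K → E M) (z : Fin K → E M × ℝ) :
    Fin K → E M :=
  fun l => gradW (Q l) (w l) ((z l).1 + δ l) (z l).2

theorem wsq_advGrad_le (hπ : IsPerronVector A π)
    (hs : ∀ k, SmoothLoss (Q k) ε L₁ L₂ L₃ L₄ L₅)
    (h : ∀ l, IsWorstCase (Q l) ε (w l) (z l).1 (z l).2 (δ l)) (c v : E M) :
    wsq π (advGrad Q w δ z)
      ≤ 3 * (∑ l, π l * gradBound (Q l) ε L₂ v (z l) ^ 2 + L₁ ^ 2 * ‖c - v‖ ^ 2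
        + L₁ ^ 2 * wsq π (w - fun _ => c)) := by
  have h1 : wsq π (advGrad Q w δ z) ≤ ∑ l, π l * (3 * (gradBound (Q l) ε L₂ v (z l) ^ 2
      + L₁ ^ 2 * ‖c - v‖ ^ 2 + L₁ ^ 2 * ‖w l - c‖ ^ 2)) :=
    Finset.sum_le_sum fun l _ => mul_le_mul_of_nonneg_left
      ((h l).norm_gradW_sq_le (hs l) c v) (hπ.pos l).le
  refine h1.trans_eq ?_
  have h2 : L₁ ^ 2 * ‖c - v‖ ^ 2 = ∑ l, π l * (L₁ ^ 2 * ‖c - v‖ ^ 2) := by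
    rw [← Finset.sum_mul, hπ.sum_eq_one, one_mul]
  conv_rhs => rw [h2]
  rw [wsq, Finset.mul_sum, ← Finset.sum_add_distrib, ← Finset.sum_add_distrib, Finset.mul_sum]
  refine Finset.sum_congr rfl fun l _ => ?_
  simp only [Pi.sub_apply]
  ring

theorem norm_sub_smul_wavg_sq_le (hπ : IsPerronVector A π) (hε : 0 ≤ ε) (hν : 0 < ν)
    (hc : ∀ k, StronglyConvexLoss (Q k) ν) (hs : ∀ k, SmoothLoss (Q k) ε L₁ L₂ L₃ L₄ L₅)
    {μ : ℝ} (hμ : 0 ≤ μ) (hμ1 : μ ≤ 1)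
    (h : ∀ l, IsWorstCase (Q l) ε (w l) (z l).1 (z l).2 (δ l)) (c v : E M) :
    ‖c - μ • wavg π (advGrad Q w δ z) - v‖ ^ 2
      ≤ (1 + μ * (ν / 4) + 3 * L₁ ^ 2 * μ ^ 2) * ‖c - v‖ ^ 2
        - 2 * μ * ∑ l, π l * (advLoss (Q l) ε c (z l).1 (z l).2
          - advLoss (Q l) ε v (z l).1 (z l).2)
        + (2 + 16 * L₁ ^ 2 / ν + 2 * |L₁| + 3 * L₁ ^ 2) * wsq π (w - fun _ => c)
        + 5 * μ ^ 2 * ∑ l, π l * gradBound (Q l) ε L₂ v (z l) ^ 2 := by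
  set g := advGrad Q w δ z with hg
  set S := ∑ l, π l * gradBound (Q l) ε L₂ v (z l) ^ 2 with hS
  set W := wsq π (w - fun _ => c) with hW
  have hW0 : 0 ≤ W := wsq_nonneg (fun k => (hπ.pos k).le) _
  have h1 : ‖c - μ • wavg π g - v‖ ^ 2
      = ‖c - v‖ ^ 2 - 2 * μ * inner ℝ (wavg π g) (c - v) + μ ^ 2 * ‖wavg π g‖ ^ 2 := by
    have : c - μ • wavg π g - v = (c - v) - μ • wavg π g := by abel
    rw [this, norm_sub_sq_real, inner_smul_right, norm_smul, mul_pow, Real.norm_eq_abs, sq_abs,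
      real_inner_comm]
    ring
  have h2 : ‖wavg π g‖ ^ 2 ≤ 3 * (S + L₁ ^ 2 * ‖c - v‖ ^ 2 + L₁ ^ 2 * W) :=
    (norm_wavg_sq_le hπ g).trans (wsq_advGrad_le hπ hs h c v)
  have h3 : -(2 * μ) * inner ℝ (wavg π g) (c - v)
      ≤ ∑ l, π l * (-(2 * μ) * (advLoss (Q l) ε c (z l).1 (z l).2
            - advLoss (Q l) ε v (z l).1 (z l).2)
          + 2 * μ ^ 2 * gradBound (Q l) ε L₂ v (z l) ^ 2 + μ * (ν / 4) * ‖c - v‖ ^ 2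
          + (2 + μ * (16 * L₁ ^ 2 / ν + 2 * |L₁|)) * ‖w l - c‖ ^ 2) := by
    rw [wavg, sum_inner, Finset.mul_sum]
    refine Finset.sum_le_sum fun l _ => ?_
    rw [real_inner_smul_left]
    have := mul_le_mul_of_nonneg_left ((h l).neg_inner_le hε hν (hc l) (hs l) hμ c v) (hπ.pos l).le
    calc _ = π l * (-(2 * μ) * inner ℝ (g l) (c - v)) := by ring
      _ ≤ _ := this
  have h4 : ∑ l, π l * (-(2 * μ) * (advLoss (Q l) ε c (z l).1 (z l).2
            - advLoss (Q l) ε v (z l).1 (z l).2)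
          + 2 * μ ^ 2 * gradBound (Q l) ε L₂ v (z l) ^ 2 + μ * (ν / 4) * ‖c - v‖ ^ 2
          + (2 + μ * (16 * L₁ ^ 2 / ν + 2 * |L₁|)) * ‖w l - c‖ ^ 2)
      = -(2 * μ) * ∑ l, π l * (advLoss (Q l) ε c (z l).1 (z l).2
            - advLoss (Q l) ε v (z l).1 (z l).2)
          + 2 * μ ^ 2 * S + μ * (ν / 4) * ‖c - v‖ ^ 2
          + (2 + μ * (16 * L₁ ^ 2 / ν + 2 * |L₁|)) * W := by
    have h5 : μ * (ν / 4) * ‖c - v‖ ^ 2 = ∑ l, π l * (μ * (ν / 4) * ‖c - v‖ ^ 2) := by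
      rw [← Finset.sum_mul, hπ.sum_eq_one, one_mul]
    conv_rhs => rw [h5]
    rw [hS, hW, wsq]
    simp only [Finset.mul_sum, ← Finset.sum_add_distrib, Pi.sub_apply]
    exact Finset.sum_congr rfl fun _ _ => by ring
  rw [h4] at h3
  have h6 := mul_le_mul_of_nonneg_left h2 (sq_nonneg μ)
  have h7 : μ * (16 * L₁ ^ 2 / ν + 2 * |L₁|) * W ≤ (16 * L₁ ^ 2 / ν + 2 * |L₁|) * W :=
    mul_le_mul_of_nonneg_right (mul_le_of_le_one_left (by positivity) hμ1) hW0
  have h8 : μ ^ 2 * (3 * L₁ ^ 2 * W) ≤ 3 * L₁ ^ 2 * W :=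
    mul_le_of_le_one_left (by positivity) (pow_le_one₀ hμ hμ1)
  rw [h1]
  linarith

theorem wavg_sub (U W : Fin K → E M) : wavg π (U - W) = wavg π U - wavg π W := by
  simp [wavg, smul_sub]

theorem wavg_smul (c : ℝ) (U : Fin K → E M) : wavg π (c • U) = c • wavg π U := by
  simp [wavg, Finset.smul_sum, smul_comm c]

theorem wavg_const (hπ : ∑ k, π k = 1) (v : E M) : wavg π (fun _ => v) = v := by
  simp [wavg, ← Finset.sum_smul, hπ]

theorem wsq_sub_wavg_le (hπ : IsPerronVector A π) (g : Fin K → E M) :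
    wsq π (g - fun _ => wavg π g) ≤ 4 * wsq π g := by
  have h6 := wsq_sub_le (fun k => (hπ.pos k).le) g (fun _ => wavg π g) one_pos
  have h7 : wsq π (fun _ : Fin K => wavg π g) = ‖wavg π g‖ ^ 2 := by
    rw [wsq, ← Finset.sum_mul, hπ.sum_eq_one, one_mul]
  have h8 := norm_wavg_sq_le hπ g
  rw [h7, inv_one] at h6
  linarith

/-- Mixing preserves averages and fixes constants, so the new deviation is the mixture of the old
one minus `μ` times the deviation of `g`. Both have zero average, so the contraction applies. -/
theorem mixSq_disagreement_le (hA : StronglyConnected A) (hπ : IsPerronVector A π) {θ : ℝ}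
    (hθ : 0 < θ) {m : ℕ}
    (hcontr : ∀ U : Fin K → E M, wavg π U = 0 → mixSq A π θ m (mix A U) ≤ θ * mixSq A π θ m U)
    {s : ℝ} (hs : 0 < s) (μ : ℝ) (w g : Fin K → E M) :
    mixSq A π θ m (mix A (w - μ • g) - fun _ => wavg π (mix A (w - μ • g)))
      ≤ θ * (1 + s) * mixSq A π θ m (w - fun _ => wavg π w)
        + θ * (1 + s⁻¹) * (4 * ∑ j ∈ Finset.range m, (θ ^ j)⁻¹) * μ ^ 2 * wsq π g := by
  have hπ0 : ∀ k, 0 ≤ π k := fun k => (hπ.pos k).le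
  have h1 : mix A (w - μ • g) - (fun _ => wavg π (mix A (w - μ • g)))
      = mix A ((w - fun _ => wavg π w) - μ • (g - fun _ => wavg π g)) := by
    rw [wavg_mix hπ.eigen, wavg_sub, wavg_smul]
    conv_lhs => rw [← mix_const hA (wavg π w - μ • wavg π g), ← mix_sub]
    congr 1
    ext1 k
    simp only [Pi.sub_apply, Pi.smul_apply]
    module
  have h2 : wavg π ((w - fun _ => wavg π w) - μ • (g - fun _ => wavg π g)) = 0 := by
    simp only [wavg_sub, wavg_smul, wavg_const hπ.sum_eq_one, sub_self, smul_zero]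
  have h3 := mixSq_sub_le (A := A) hπ0 hθ m (w - fun _ => wavg π w)
    (μ • (g - fun _ => wavg π g)) hs
  rw [mixSq_smul] at h3
  have h4 := mixSq_le hA hπ hθ m (g - fun _ => wavg π g)
  have h5 := wsq_sub_wavg_le hπ g
  rw [h1]
  refine (hcontr _ h2).trans ?_
  have hc0 : 0 ≤ ∑ j ∈ Finset.range m, (θ ^ j)⁻¹ := Finset.sum_nonneg fun j _ => by positivity
  have h9 := mul_le_mul_of_nonneg_left h5 hc0
  have h10 : (1 + s⁻¹) * (μ ^ 2 * mixSq A π θ m (g - fun _ => wavg π g))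
      ≤ (1 + s⁻¹) * (μ ^ 2 * ((∑ j ∈ Finset.range m, (θ ^ j)⁻¹) * (4 * wsq π g))) := by
    gcongr
    exact h4.trans h9
  have h11 := mul_le_mul_of_nonneg_left (h3.trans (add_le_add_right h10 _)) hθ.le
  refine h11.trans_eq (by ring)

end OneStep

/-! ### Measurability, independence and square-integrability of the models -/

section Trajectory

variable {K M : ℕ} {A : Matrix (Fin K) (Fin K) ℝ} {π : Fin K → ℝ} {D : Measure (E M × ℝ)}
  {Q : Fin K → Loss M} {ε ν L₁ L₂ L₃ L₄ L₅ μ : ℝ}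
  {Ω : Type*} [MeasurableSpace Ω] {P : Measure Ω}
  {ξ : ℕ → Fin K → Ω → E M × ℝ} {w δ : ℕ → Fin K → Ω → E M}

/-- The perturbations are not assumed measurable; where the worst case is unique, the gradient is
nevertheless a measurable function of model and sample. -/
theorem exists_measurable_advGrad {q : Loss M} (hε : 0 ≤ ε)
    (hr : RegularLoss q ε D) (hs : SmoothLoss q ε L₁ L₂ L₃ L₄ L₅) :
    ∃ γ : E M × (E M × ℝ) → E M, Measurable γ ∧ ∀ (w δ : E M) (z : E M × ℝ),
      IsWorstCase q ε w z.1 z.2 δ → (∃! d, IsWorstCase q ε w z.1 z.2 d) →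
      gradW q w (z.1 + δ) z.2 = γ (w, z) := by
  obtain ⟨s, hsm, hsel⟩ := exists_measurable_worstCase hε hr hs
  refine ⟨fun p => gradW q p.1 (p.2.1 + s p) p.2.2, ?_, fun w δ z h hu => ?_⟩
  · exact (hs.continuous_gradW hε).measurable.comp (measurable_fst.prodMk
      ((measurable_snd.fst.add hsm).prodMk measurable_snd.snd))
  · rw [← hsel w z.1 δ z.2 h hu]

theorem IsAdvATC.mix_advGrad (h : IsAdvATC A Q ε μ ξ P w δ) : ∀ᵐ ω ∂P, ∀ n,
    (fun k => w (n + 1) k ω) = mix A ((fun l => w n l ω)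
      - μ • advGrad Q (fun l => w n l ω) (fun l => δ n l ω) (fun l => ξ n l ω)) := by
  filter_upwards [h.combine] with ω hω n
  ext1 k
  exact hω n k

/-- The models are measurable functions of the initial models and the past samples. -/
theorem IsAdvATC.exists_measurable_history (hε : 0 ≤ ε) (hr : ∀ k, RegularLoss (Q k) ε D)
    (hs : ∀ k, SmoothLoss (Q k) ε L₁ L₂ L₃ L₄ L₅)
    (h : IsAdvATC A Q ε μ ξ P w δ) (hu : UniqueWorstCase Q ε ξ P w) (n : ℕ) :
    ∃ Φ : (Fin K → E M) × (↥(Finset.range n ×ˢ (Finset.univ : Finset (Fin K))) → E M × ℝ)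
        → Fin K → E M,
      Measurable Φ ∧ ∀ᵐ ω ∂P, (fun k => w n k ω) = Φ (history (w 0) ξ n ω) := by
  choose γ hγm hγ using fun k => exists_measurable_advGrad hε (hr k) (hs k)
  induction n with
  | zero => exact ⟨Prod.fst, measurable_fst, Eventually.of_forall fun ω => rfl⟩
  | succ n ih =>
    obtain ⟨Φ, hΦ, heq⟩ := ih
    have hincl : Finset.range n ×ˢ (Finset.univ : Finset (Fin K))
        ⊆ Finset.range (n + 1) ×ˢ Finset.univ :=
      Finset.product_subset_product_left (Finset.range_subset_range.2 n.le_succ)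
    have hmem : ∀ l : Fin K, (n, l) ∈ Finset.range (n + 1) ×ˢ (Finset.univ : Finset (Fin K)) :=
      fun l => by simp
    -- `Ψ` reads the models at time `n` from the longer history, whose additional samples drive the
    -- next step.
    set Ψ : (Fin K → E M) × (↥(Finset.range (n + 1) ×ˢ (Finset.univ : Finset (Fin K)))
        → E M × ℝ) → Fin K → E M := fun p => Φ (p.1, fun i => p.2 ⟨i.1, hincl i.2⟩) with hΨ
    have hΨm : Measurable Ψ := hΦ.comp (by fun_prop)
    refine ⟨fun p => mix A (Ψ p - μ • fun l => γ l (Ψ p l, p.2 ⟨(n, l), hmem l⟩)), ?_, ?_⟩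
    · refine measurable_pi_lambda _ fun k => Finset.measurable_sum _ fun l _ => ?_
      refine Measurable.const_smul (M := ℝ) (Measurable.sub ?_ (Measurable.const_smul (M := ℝ)
        ((hγm l).comp (Measurable.prodMk ?_ (by fun_prop))) μ)) (A l k)
      · exact (measurable_pi_apply l).comp hΨm
      · exact (measurable_pi_apply l).comp hΨm
    · filter_upwards [heq, h.mix_advGrad, h.worst_case, hu] with ω h1 h2 h3 h4
      have h5 : Ψ (history (w 0) ξ (n + 1) ω) = fun k => w n k ω := h1.symm
      rw [h2 n, h5]
      congr 3
      ext1 l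
      exact hγ l _ _ _ (h3 n l) (h4 n l)

theorem IsAdvATC.aemeasurable (hε : 0 ≤ ε) (hr : ∀ k, RegularLoss (Q k) ε D)
    (hs : ∀ k, SmoothLoss (Q k) ε L₁ L₂ L₃ L₄ L₅) (hξ : IIDSamples ξ D P)
    (hw : AdmissibleInit (w 0) ξ P)
    (h : IsAdvATC A Q ε μ ξ P w δ) (hu : UniqueWorstCase Q ε ξ P w) (n : ℕ) :
    AEMeasurable (fun ω k => w n k ω) P := by
  obtain ⟨Φ, hΦ, heq⟩ := h.exists_measurable_history hε hr hs hu n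
  exact ⟨_, hΦ.comp (measurable_history hξ hw n), heq⟩

theorem IsAdvATC.indepFun [IsProbabilityMeasure P] (hε : 0 ≤ ε) (hr : ∀ k, RegularLoss (Q k) ε D)
    (hs : ∀ k, SmoothLoss (Q k) ε L₁ L₂ L₃ L₄ L₅) (hξ : IIDSamples ξ D P)
    (hw : AdmissibleInit (w 0) ξ P)
    (h : IsAdvATC A Q ε μ ξ P w δ) (hu : UniqueWorstCase Q ε ξ P w) (n : ℕ) (k : Fin K) :
    IndepFun (fun ω k => w n k ω) (ξ n k) P := by
  obtain ⟨Φ, hΦ, heq⟩ := h.exists_measurable_history hε hr hs hu n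
  refine IndepFun.congr ((indepFun_history hξ hw n k).comp hΦ measurable_id) ?_ .rfl
  exact heq.mono fun ω hω => hω.symm

theorem IsAdvATC.memLp_advGrad [IsProbabilityMeasure P] [IsProbabilityMeasure D] (hε : 0 ≤ ε)
    (hr : ∀ k, RegularLoss (Q k) ε D)
    (hs : ∀ k, SmoothLoss (Q k) ε L₁ L₂ L₃ L₄ L₅) (hξ : IIDSamples ξ D P)
    (h : IsAdvATC A Q ε μ ξ P w δ) (hu : UniqueWorstCase Q ε ξ P w) {n : ℕ}
    (hL : ∀ k, MemLp (w n k) 2 P) (l : Fin K) :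
    MemLp (fun ω => advGrad Q (fun l => w n l ω) (fun l => δ n l ω) (fun l => ξ n l ω) l) 2 P := by
  obtain ⟨γ, hγm, hγ⟩ := exists_measurable_advGrad hε (hr l) (hs l)
  have hg : MemLp (fun ω => gradBound (Q l) ε L₂ 0 (ξ n l ω)) 2 P :=
    memLp_comp_of_map_eq (hξ.measurable n l) (hξ.law n l) ((hr l).memLp_gradBound L₂ 0)
  refine (hg.add ((hL l).norm.const_mul |L₁|)).of_le ?_ ?_
  · have h1 : AEMeasurable (fun ω => γ (w n l ω, ξ n l ω)) P :=
      hγm.comp_aemeasurable ((hL l).aestronglyMeasurable.aemeasurable.prodMk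
        (hξ.measurable n l).aemeasurable)
    refine h1.aestronglyMeasurable.congr ?_
    filter_upwards [h.worst_case, hu] with ω h3 h4
    exact (hγ _ _ _ (h3 n l) (h4 n l)).symm
  · filter_upwards [h.worst_case] with ω h3
    have h5 := (hs l).norm_gradW_le 0 (w n l ω) (ξ n l ω).1 (ξ n l ω).2 (h3 n l).1
    rw [sub_zero] at h5
    exact h5.trans (le_abs_self _)

theorem memLp_mix {U : Fin K → Ω → E M} (hU : ∀ k, MemLp (U k) 2 P)
    (B : Matrix (Fin K) (Fin K) ℝ) (k : Fin K) :
    MemLp (fun ω => mix B (fun l => U l ω) k) 2 P :=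
  memLp_finsetSum _ fun l _ => (hU l).const_smul (B l k)

theorem memLp_wavg {U : Fin K → Ω → E M} (hU : ∀ k, MemLp (U k) 2 P) (π : Fin K → ℝ) :
    MemLp (fun ω => wavg π (fun l => U l ω)) 2 P :=
  memLp_finsetSum _ fun l _ => (hU l).const_smul (π l)

theorem integrable_wsq {U : Fin K → Ω → E M} (hU : ∀ k, MemLp (U k) 2 P) (π : Fin K → ℝ) :
    Integrable (fun ω => wsq π (fun l => U l ω)) P :=
  integrable_finsetSum _ fun l _ => ((hU l).norm.integrable_sq).const_mul (π l)

theorem integrable_mixSq {U : Fin K → Ω → E M} (hU : ∀ k, MemLp (U k) 2 P)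
    (A : Matrix (Fin K) (Fin K) ℝ) (π : Fin K → ℝ) (θ : ℝ) (m : ℕ) :
    Integrable (fun ω => mixSq A π θ m (fun l => U l ω)) P := by
  refine integrable_finsetSum _ fun j _ => Integrable.const_mul ?_ _
  simp only [iterate_mix]
  exact integrable_wsq (U := fun k ω => mix (A ^ j) (fun l => U l ω) k) (memLp_mix hU _) π

theorem IsAdvATC.memLp [IsProbabilityMeasure P] [IsProbabilityMeasure D] (hε : 0 ≤ ε)
    (hr : ∀ k, RegularLoss (Q k) ε D)
    (hs : ∀ k, SmoothLoss (Q k) ε L₁ L₂ L₃ L₄ L₅) (hξ : IIDSamples ξ D P)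
    (hw : AdmissibleInit (w 0) ξ P)
    (h : IsAdvATC A Q ε μ ξ P w δ) (hu : UniqueWorstCase Q ε ξ P w) (n : ℕ) (k : Fin K) :
    MemLp (w n k) 2 P := by
  induction n generalizing k with
  | zero => exact hw.memLp k
  | succ n ih =>
    have h1 := memLp_mix (U := fun l ω => w n l ω - μ • advGrad Q (fun l => w n l ω)
      (fun l => δ n l ω) (fun l => ξ n l ω) l) (fun l => (ih l).sub
      ((h.memLp_advGrad hε hr hs hξ hu ih l).const_smul μ)) A k
    refine h1.ae_eq ?_
    filter_upwards [h.mix_advGrad] with ω hω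
    exact (congrFun (hω n) k).symm

end Trajectory

/-! ### Coupled recursion for centroid error and disagreement -/

section Recursion

theorem geometric_bound {x : ℕ → ℝ} {r t : ℝ} (hr0 : 0 ≤ r) (hr1 : r < 1) (ht : 0 ≤ t)
    (h : ∀ n, x (n + 1) ≤ r * x n + t) (n : ℕ) : x n ≤ x 0 * r ^ n + t / (1 - r) := by
  have h1 : 0 < 1 - r := by linarith
  induction n with
  | zero => simp only [pow_zero, mul_one]; linarith [div_nonneg ht h1.le]
  | succ n ih =>
    have h2 := mul_le_mul_of_nonneg_left ih hr0
    have h3 : r * (t / (1 - r)) + t = t / (1 - r) := by field_simp; ring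
    calc x (n + 1) ≤ r * x n + t := h n
      _ ≤ r * (x 0 * r ^ n + t / (1 - r)) + t := by linarith
      _ = x 0 * r ^ (n + 1) + (r * (t / (1 - r)) + t) := by ring
      _ = _ := by rw [h3]

/-- Stability of the coupled recursion for the centroid error `V` and the disagreement `D`. -/
theorem exists_coupled_recursion_bound {ν l H ρ C₁ C₂ : ℝ} (hν : 0 < ν) (hl : 0 ≤ l) (hH : 0 ≤ H)
    (hρ0 : 0 ≤ ρ) (hρ1 : ρ < 1) (hC₁ : 0 ≤ C₁) (hC₂ : 0 ≤ C₂) :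
    ∃ μ₀ > 0, ∃ a > 0, ∃ κ ≥ 1, ∃ c : ℝ, μ₀ ≤ 1 ∧ a * μ₀ < 1 ∧
      ∀ (V D : ℕ → ℝ) (μ : ℝ), (∀ n, 0 ≤ V n) → (∀ n, 0 ≤ D n) → 0 < μ → μ ≤ μ₀ →
        (∀ n, V (n + 1) ≤ (1 - μ * (ν / 4) + 3 * l * μ ^ 2) * V n + C₁ * D n + 5 * μ ^ 2 * H) →
        (∀ n, D (n + 1) ≤ ρ * D n + C₂ * μ ^ 2 * (3 * (H + l * V n + l * D n))) →
        ∀ n, V n + κ * D n ≤ (V 0 + κ * D 0) * (1 - a * μ) ^ n + c * μ := by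
  have hρ : 0 < 1 - ρ := by linarith
  -- With this weight, half of the contraction gap `1 - ρ` absorbs the coupling `C₁`; the other half
  -- is left for terms of order `μ`.
  obtain ⟨κ, hκ⟩ : ∃ κ, κ = 2 * C₁ / (1 - ρ) + 1 := ⟨_, rfl⟩
  have hκ1 : 1 ≤ κ := by
    have : 0 ≤ 2 * C₁ / (1 - ρ) := by positivity
    linarith
  have hκC : C₁ ≤ κ * ((1 - ρ) / 2) := by
    have : κ * ((1 - ρ) / 2) = C₁ + (1 - ρ) / 2 := by rw [hκ]; field_simp
    linarith
  have hκ0 : 0 ≤ κ := by linarith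
  obtain ⟨B, hB⟩ : ∃ B, B = 3 * l * (1 + κ * C₂) := ⟨_, rfl⟩
  have hB0 : 0 ≤ B := by rw [hB]; positivity
  set a := ν / 8 with ha
  have ha0 : 0 < a := by positivity
  have hden : 0 < 2 * (a + 3 * C₂ * l) := by positivity
  -- The bounds serve, in order, `μ ^ 2 ≤ μ`; absorbing `B * μ ^ 2` into the spare half `a = ν / 8`
  -- of the centroid rate `ν / 4`; and fitting the remaining terms of order `μ` into the other half
  -- of `1 - ρ`. The last one also gives `a * μ₀ < 1`.
  obtain ⟨μ₀, hμ₀⟩ : ∃ μ₀, μ₀ = min 1 (min (a / (B + 1)) ((1 - ρ) / (2 * (a + 3 * C₂ * l)))) :=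
    ⟨_, rfl⟩
  have hle1 : μ₀ ≤ 1 := hμ₀ ▸ min_le_left _ _
  have hle2 : μ₀ ≤ a / (B + 1) := hμ₀ ▸ (min_le_right _ _).trans (min_le_left _ _)
  have hle3 : μ₀ ≤ (1 - ρ) / (2 * (a + 3 * C₂ * l)) :=
    hμ₀ ▸ (min_le_right _ _).trans (min_le_right _ _)
  have hpos : 0 < μ₀ := by
    rw [hμ₀]
    exact lt_min one_pos (lt_min (by positivity) (by positivity))
  rw [le_div_iff₀ (by positivity)] at hle2
  rw [le_div_iff₀ hden] at hle3
  have hCl : 0 ≤ 3 * C₂ * l := by positivity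
  refine ⟨μ₀, hpos, a, ha0, κ, hκ1, H * (5 + 3 * κ * C₂) / a, hle1, ?_, ?_⟩
  · nlinarith [mul_nonneg hpos.le hCl]
  intro V D μ hV hD hμ hμle hVrec hDrec n
  have hμ1 : μ ≤ 1 := hμle.trans hle1
  have hBμ : B * μ ≤ a := by nlinarith
  have hDμ : 2 * (a + 3 * C₂ * l) * μ ≤ 1 - ρ := by nlinarith
  have haμ : a * μ < 1 := by nlinarith [mul_nonneg hμ.le hCl]
  have hstep : ∀ n, V (n + 1) + κ * D (n + 1)
      ≤ (1 - a * μ) * (V n + κ * D n) + μ ^ 2 * (H * (5 + 3 * κ * C₂)) := by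
    intro n
    have h1 := mul_le_mul_of_nonneg_left (hDrec n) hκ0
    have h2 : (1 - μ * (ν / 4) + B * μ ^ 2) * V n ≤ (1 - a * μ) * V n := by
      refine mul_le_mul_of_nonneg_right ?_ (hV n)
      have := mul_le_mul_of_nonneg_left hBμ hμ.le
      rw [ha] at this ⊢
      linarith
    have h3 : (C₁ + κ * (ρ + 3 * C₂ * l * μ ^ 2)) * D n ≤ (1 - a * μ) * κ * D n := by
      refine mul_le_mul_of_nonneg_right ?_ (hD n)
      have h4 : 3 * C₂ * l * μ ^ 2 ≤ 3 * C₂ * l * μ :=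
        mul_le_mul_of_nonneg_left (by nlinarith) hCl
      have h5 : κ * (ρ + 3 * C₂ * l * μ ^ 2) ≤ κ * (ρ + 3 * C₂ * l * μ) := by gcongr
      have h6 : κ * ((a + 3 * C₂ * l) * μ) ≤ κ * ((1 - ρ) / 2) :=
        mul_le_mul_of_nonneg_left (by linarith) hκ0
      linarith
    have h7 : V (n + 1) + κ * D (n + 1) ≤ (1 - μ * (ν / 4) + B * μ ^ 2) * V n
        + (C₁ + κ * (ρ + 3 * C₂ * l * μ ^ 2)) * D n + μ ^ 2 * (H * (5 + 3 * κ * C₂)) := by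
      have := add_le_add (hVrec n) h1
      refine this.trans_eq ?_
      rw [hB]; ring
    linarith
  have := geometric_bound (x := fun n => V n + κ * D n) (by linarith : 0 ≤ 1 - a * μ)
    (by nlinarith) (by positivity) hstep n
  refine this.trans_eq ?_
  congr 1
  rw [sub_sub_cancel]
  field_simp

variable {K M : ℕ} {A : Matrix (Fin K) (Fin K) ℝ} {π : Fin K → ℝ} {D : Measure (E M × ℝ)}
  {Q : Fin K → Loss M} {ε ν L₁ L₂ L₃ L₄ L₅ μ : ℝ}
  {Ω : Type*} [MeasurableSpace Ω] {P : Measure Ω}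
  {ξ : ℕ → Fin K → Ω → E M × ℝ} {w δ : ℕ → Fin K → Ω → E M}

/-- The deviation of the models from their weighted average. -/
noncomputable def deviation (π : Fin K → ℝ) (W : Fin K → E M) : Fin K → E M := W - fun _ => wavg π W

/-- The averaged second moment of the gradient bounds at `v`. -/
noncomputable def gradMoment (Q : Fin K → Loss M) (ε L : ℝ) (D : Measure (E M × ℝ))
    (π : Fin K → ℝ) (v : E M) : ℝ :=
  ∑ l, π l * ∫ z, gradBound (Q l) ε L v z ^ 2 ∂D

theorem IsAdvATC.wavg_succ (hπ : IsPerronVector A π) (h : IsAdvATC A Q ε μ ξ P w δ) :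
    ∀ᵐ ω ∂P, ∀ n, wavg π (fun k => w (n + 1) k ω) = wavg π (fun k => w n k ω)
      - μ • wavg π (advGrad Q (fun l => w n l ω) (fun l => δ n l ω) (fun l => ξ n l ω)) := by
  filter_upwards [h.mix_advGrad] with ω hω n
  rw [hω n, wavg_mix hπ.eigen, wavg_sub, wavg_smul]

theorem memLp_deviation {U : Fin K → Ω → E M} (hU : ∀ k, MemLp (U k) 2 P) (π : Fin K → ℝ)
    (k : Fin K) : MemLp (fun ω => deviation π (fun l => U l ω) k) 2 P :=
  (hU k).sub (memLp_wavg hU π)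

theorem integrable_norm_wavg_sub_sq [IsProbabilityMeasure P] {U : Fin K → Ω → E M}
    (hU : ∀ k, MemLp (U k) 2 P) (π : Fin K → ℝ) (v : E M) :
    Integrable (fun ω => ‖wavg π (fun k => U k ω) - v‖ ^ 2) P :=
  ((memLp_wavg hU π).sub (memLp_const v)).norm.integrable_sq

theorem integrable_gradBound_sq [IsProbabilityMeasure D] (hr : ∀ k, RegularLoss (Q k) ε D)
    (hξ : IIDSamples ξ D P) (L : ℝ) (v : E M) (n : ℕ) (l : Fin K) :
    Integrable (fun ω => gradBound (Q l) ε L v (ξ n l ω) ^ 2) P :=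
  (memLp_comp_of_map_eq (hξ.measurable n l) (hξ.law n l)
    ((hr l).memLp_gradBound L v)).integrable_sq

theorem integral_sum_gradBound_sq [IsProbabilityMeasure D] (hr : ∀ k, RegularLoss (Q k) ε D)
    (hξ : IIDSamples ξ D P) (L : ℝ) (v : E M) (n : ℕ) :
    ∫ ω, ∑ l, π l * gradBound (Q l) ε L v (ξ n l ω) ^ 2 ∂P = gradMoment Q ε L D π v := by
  rw [integral_finsetSum _ fun l _ => (integrable_gradBound_sq hr hξ L v n l).const_mul (π l)]
  refine Finset.sum_congr rfl fun l _ => ?_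
  rw [integral_const_mul]
  congr 1
  have h1 := ((hr l).memLp_gradBound L v).integrable_sq.aestronglyMeasurable
  rw [← hξ.law n l] at h1 ⊢
  exact (integral_map (hξ.measurable n l).aemeasurable h1).symm

/-- In expectation the excess loss is at least `ν / 4` times the centroid error, so `1 + μ * (ν /
4)` of the pathwise bound drops to `1 - μ * (ν / 4)`. Independence from each sample `ξ n l`
separately suffices, as the loss terms are summed over agents. -/
theorem IsAdvATC.centroid_recursion [IsProbabilityMeasure P] [IsProbabilityMeasure D]
    (hπ : IsPerronVector A π) (hε : 0 ≤ ε) (hν : 0 < ν) (hr : ∀ k, RegularLoss (Q k) ε D)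
    (hc : ∀ k, StronglyConvexLoss (Q k) ν)
    (hs : ∀ k, SmoothLoss (Q k) ε L₁ L₂ L₃ L₄ L₅) {wstar : E M}
    (hmin : ∀ w, aggRisk Q ε D π wstar ≤ aggRisk Q ε D π w) (hξ : IIDSamples ξ D P)
    (hw : AdmissibleInit (w 0) ξ P)
    (h : IsAdvATC A Q ε μ ξ P w δ) (hu : UniqueWorstCase Q ε ξ P w) (hμ : 0 ≤ μ) (hμ1 : μ ≤ 1)
    (n : ℕ) :
    ∫ ω, ‖wavg π (fun k => w (n + 1) k ω) - wstar‖ ^ 2 ∂P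
      ≤ (1 - μ * (ν / 4) + 3 * L₁ ^ 2 * μ ^ 2)
          * ∫ ω, ‖wavg π (fun k => w n k ω) - wstar‖ ^ 2 ∂P
        + (2 + 16 * L₁ ^ 2 / ν + 2 * |L₁| + 3 * L₁ ^ 2)
          * ∫ ω, wsq π (deviation π (fun k => w n k ω)) ∂P
        + 5 * μ ^ 2 * gradMoment Q ε L₂ D π wstar := by
  have hL := h.memLp hε hr hs hξ hw hu
  have hcL : MemLp (fun ω => wavg π (fun k => w n k ω)) 2 P := memLp_wavg (hL n) π
  have hind : ∀ l, IndepFun (fun ω => wavg π (fun k => w n k ω)) (ξ n l) P := fun l =>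
    (h.indepFun hε hr hs hξ hw hu n l).comp (φ := wavg π) (ψ := id)
      (Finset.measurable_sum _ fun k _ => (measurable_pi_apply k).const_smul (π k)) measurable_id
  have hF := fun l => integrable_advLoss_sub hε hν.le (hr l) (hc l) (hs l) wstar
    (hξ.measurable n l) (hξ.law n l) hcL
  have hJ := fun l => integral_advLoss_sub hε hν.le (hr l) (hc l) (hs l) wstar
    (hξ.measurable n l) (hξ.law n l) hcL (hind l)
  have iV := integrable_norm_wavg_sub_sq (hL n) π wstar
  have iV' := integrable_norm_wavg_sub_sq (hL (n + 1)) π wstar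
  have iS : Integrable (fun ω => wsq π (deviation π (fun k => w n k ω))) P :=
    integrable_wsq (memLp_deviation (hL n) π) π
  have iF := integrable_finsetSum Finset.univ fun l _ => (hF l).const_mul (π l)
  have iH := integrable_finsetSum Finset.univ fun l _ =>
    (integrable_gradBound_sq hr hξ L₂ wstar n l).const_mul (π l)
  have hint := integral_mono_ae iV' ((((iV.const_mul
    (1 + μ * (ν / 4) + 3 * L₁ ^ 2 * μ ^ 2)).sub (iF.const_mul (2 * μ))).add
    (iS.const_mul (2 + 16 * L₁ ^ 2 / ν + 2 * |L₁| + 3 * L₁ ^ 2))).add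
    (iH.const_mul (5 * μ ^ 2))) (by
      filter_upwards [h.wavg_succ hπ, h.worst_case] with ω h1 h2
      simp only [Pi.add_apply, Pi.sub_apply]
      rw [h1 n]
      exact norm_sub_smul_wavg_sq_le hπ hε hν hc hs hμ hμ1 (h2 n) _ wstar)
  rw [integral_add' (((iV.const_mul _).sub (iF.const_mul _)).add (iS.const_mul _))
      (iH.const_mul _), integral_add' ((iV.const_mul _).sub (iF.const_mul _)) (iS.const_mul _),
    integral_sub' (iV.const_mul _) (iF.const_mul _), integral_const_mul, integral_const_mul,
    integral_const_mul, integral_const_mul, integral_sum_gradBound_sq hr hξ] at hint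
  have hgrow : ν / 4 * ∫ ω, ‖wavg π (fun k => w n k ω) - wstar‖ ^ 2 ∂P
      ≤ ∫ ω, ∑ l, π l * (advLoss (Q l) ε (wavg π fun k => w n k ω) (ξ n l ω).1 (ξ n l ω).2
          - advLoss (Q l) ε wstar (ξ n l ω).1 (ξ n l ω).2) ∂P := by
    rw [integral_finsetSum _ fun l _ => (hF l).const_mul (π l)]
    simp only [integral_const_mul, fun l => (hJ l).2]
    simp only [← integral_const_mul]
    rw [← integral_finsetSum _ fun l _ => (hJ l).1.const_mul (π l)]
    exact integral_mono (iV.const_mul _)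
      (integrable_finsetSum _ fun l _ => (hJ l).1.const_mul (π l))
      fun ω => quadratic_growth_aggRisk hπ hε hr hc hs hmin _
  have := mul_le_mul_of_nonneg_left hgrow (by positivity : 0 ≤ 2 * μ)
  linarith

/-- The pathwise bound is simply integrated: no cross term between model and sample has to be
evaluated here. -/
theorem IsAdvATC.disagreement_recursion [IsProbabilityMeasure P] [IsProbabilityMeasure D]
    (hA : StronglyConnected A) (hπ : IsPerronVector A π) (hε : 0 ≤ ε)
    (hr : ∀ k, RegularLoss (Q k) ε D) (hs : ∀ k, SmoothLoss (Q k) ε L₁ L₂ L₃ L₄ L₅)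
    (hξ : IIDSamples ξ D P) (hw : AdmissibleInit (w 0) ξ P)
    (h : IsAdvATC A Q ε μ ξ P w δ) (hu : UniqueWorstCase Q ε ξ P w) {θ : ℝ} (hθ : 0 < θ) {m : ℕ}
    (hcontr : ∀ U : Fin K → E M, wavg π U = 0 → mixSq A π θ m (mix A U) ≤ θ * mixSq A π θ m U)
    {s : ℝ} (hs0 : 0 < s) (v : E M) (n : ℕ) :
    ∫ ω, mixSq A π θ m (deviation π (fun k => w (n + 1) k ω)) ∂P
      ≤ θ * (1 + s) * ∫ ω, mixSq A π θ m (deviation π (fun k => w n k ω)) ∂P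
        + θ * (1 + s⁻¹) * (4 * ∑ j ∈ Finset.range m, (θ ^ j)⁻¹) * μ ^ 2
          * (3 * (gradMoment Q ε L₂ D π v
            + L₁ ^ 2 * ∫ ω, ‖wavg π (fun k => w n k ω) - v‖ ^ 2 ∂P
            + L₁ ^ 2 * ∫ ω, wsq π (deviation π (fun k => w n k ω)) ∂P)) := by
  have hL := h.memLp hε hr hs hξ hw hu
  have iD : ∀ n, Integrable (fun ω => mixSq A π θ m (deviation π (fun k => w n k ω))) P :=
    fun n => integrable_mixSq (memLp_deviation (hL n) π) A π θ m
  have iV := integrable_norm_wavg_sub_sq (hL n) π v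
  have iS : Integrable (fun ω => wsq π (deviation π (fun k => w n k ω))) P :=
    integrable_wsq (memLp_deviation (hL n) π) π
  have iH := integrable_finsetSum Finset.univ fun l _ =>
    (integrable_gradBound_sq hr hξ L₂ v n l).const_mul (π l)
  have hc0 : 0 ≤ θ * (1 + s⁻¹) * (4 * ∑ j ∈ Finset.range m, (θ ^ j)⁻¹) * μ ^ 2 := by
    have : 0 ≤ ∑ j ∈ Finset.range m, (θ ^ j)⁻¹ := Finset.sum_nonneg fun j _ => by positivity
    positivity
  set C := θ * (1 + s⁻¹) * (4 * ∑ j ∈ Finset.range m, (θ ^ j)⁻¹) * μ ^ 2 with hC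
  have hint := integral_mono_ae (iD (n + 1)) (((iD n).const_mul (θ * (1 + s))).add
    ((((iH.add (iV.const_mul (L₁ ^ 2))).add (iS.const_mul (L₁ ^ 2))).const_mul 3).const_mul C)) (by
      filter_upwards [h.mix_advGrad, h.worst_case] with ω h1 h2
      simp only [Pi.add_apply]
      rw [h1 n]
      refine (mixSq_disagreement_le hA hπ hθ hcontr hs0 μ _ _).trans ?_
      exact add_le_add_right (mul_le_mul_of_nonneg_left
        (wsq_advGrad_le hπ hs (h2 n) (wavg π fun k => w n k ω) v) hc0) _)
  rw [integral_add' ((iD n).const_mul _) ((((iH.add (iV.const_mul _)).add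
      (iS.const_mul _)).const_mul 3).const_mul C), integral_const_mul, integral_const_mul,
    integral_const_mul, integral_add' (iH.add (iV.const_mul _)) (iS.const_mul _),
    integral_add' iH (iV.const_mul _), integral_const_mul, integral_const_mul,
    integral_sum_gradBound_sq hr hξ] at hint
  exact hint

end Recursion

/-! ### From the coupled bound to individual agents -/

section Stability

variable {K M : ℕ} {A : Matrix (Fin K) (Fin K) ℝ} {π : Fin K → ℝ}

theorem norm_sub_sq_le_deviation (hπ : IsPerronVector A π) (W : Fin K → E M) (v : E M)
    (k : Fin K) :
    ‖v - W k‖ ^ 2 ≤ 2 * ‖wavg π W - v‖ ^ 2 + 2 * (∑ l, (π l)⁻¹) * wsq π (deviation π W) := by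
  have h1 := norm_sub_sq_le (v - wavg π W) (W k - wavg π W) one_pos
  rw [sub_sub_sub_cancel_right, inv_one, norm_sub_rev v (wavg π W)] at h1
  have h2 : π k * ‖W k - wavg π W‖ ^ 2 ≤ wsq π (deviation π W) :=
    Finset.single_le_sum (f := fun l => π l * ‖deviation π W l‖ ^ 2)
      (fun l _ => mul_nonneg (hπ.pos l).le (sq_nonneg _)) (Finset.mem_univ k)
  have h3 : (π k)⁻¹ ≤ ∑ l, (π l)⁻¹ :=
    Finset.single_le_sum (fun l _ => (inv_pos.2 (hπ.pos l)).le) (Finset.mem_univ k)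
  have h4 : ‖W k - wavg π W‖ ^ 2 ≤ (π k)⁻¹ * wsq π (deviation π W) := by
    rw [inv_mul_eq_div, le_div_iff₀ (hπ.pos k), mul_comm]
    exact h2
  have h5 := mul_le_mul_of_nonneg_right h3
    (wsq_nonneg (fun k => (hπ.pos k).le) (deviation π W))
  linarith

theorem wsq_sub_const_le (hπ : IsPerronVector A π) (W : Fin K → E M) (v : E M) :
    wsq π (W - fun _ => v) ≤ ∑ l, ‖v - W l‖ ^ 2 := by
  refine Finset.sum_le_sum fun l _ => ?_
  have h1 : π l ≤ 1 := hπ.sum_eq_one ▸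
    Finset.single_le_sum (f := π) (fun i _ => (hπ.pos i).le) (Finset.mem_univ l)
  rw [Pi.sub_apply, norm_sub_rev]
  exact mul_le_of_le_one_left (sq_nonneg _) h1

theorem norm_wavg_sub_sq_le (hπ : IsPerronVector A π) (W : Fin K → E M) (v : E M) :
    ‖wavg π W - v‖ ^ 2 ≤ ∑ l, ‖v - W l‖ ^ 2 := by
  have h1 := norm_wavg_sq_le hπ (W - fun _ => v)
  rw [wavg_sub, wavg_const hπ.sum_eq_one] at h1
  exact h1.trans (wsq_sub_const_le hπ W v)

/-- The deviation is unchanged when all models are translated by `v`. -/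
theorem wsq_deviation_le (hπ : IsPerronVector A π) (W : Fin K → E M) (v : E M) :
    wsq π (deviation π W) ≤ 4 * ∑ l, ‖v - W l‖ ^ 2 := by
  have h1 := wsq_sub_wavg_le hπ (W - fun _ => v)
  have h2 : (W - fun _ => v) - (fun _ => wavg π (W - fun _ => v)) = deviation π W := by
    ext1 k
    simp only [deviation, Pi.sub_apply, wavg_sub, wavg_const hπ.sum_eq_one]
    abel
  rw [h2] at h1
  linarith [wsq_sub_const_le hπ W v]

theorem limsup_le_of_geometric {f : ℕ → ℝ} {B r t : ℝ} (hf : ∀ n, 0 ≤ f n) (hr0 : 0 ≤ r)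
    (hr1 : r < 1) (h : ∀ n, f n ≤ B * r ^ n + t) : limsup f atTop ≤ t := by
  have hlim : Tendsto (fun n : ℕ => B * r ^ n + t) atTop (𝓝 t) := by
    simpa using ((tendsto_pow_atTop_nhds_zero_of_lt_one hr0 hr1).const_mul B).add_const t
  rw [← hlim.limsup_eq]
  -- Nonnegativity of `f` supplies the coboundedness that the real-valued limsup needs.
  exact limsup_le_limsup (Eventually.of_forall h)
    (isCoboundedUnder_le_of_le atTop hf) hlim.isBoundedUnder_le

/-- Error bounds for the individual agents from a bound for the centroid error and the
disagreement. -/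
theorem integral_norm_sub_sq_le_of_coupled_bound {Ω : Type*} [MeasurableSpace Ω] {P : Measure Ω}
    [IsProbabilityMeasure P] {w : ℕ → Fin K → Ω → E M} (hA : StronglyConnected A)
    (hπ : IsPerronVector A π) {θ : ℝ} (hθ : 0 < θ) {m : ℕ} (hm : 0 < m)
    (hL : ∀ n k, MemLp (w n k) 2 P) (v : E M) {κ r t : ℝ} (hκ : 1 ≤ κ) (hr : 0 ≤ r)
    (hbound : ∀ n, ∫ ω, ‖wavg π (fun k => w n k ω) - v‖ ^ 2 ∂P
        + κ * ∫ ω, mixSq A π θ m (deviation π (fun k => w n k ω)) ∂P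
      ≤ (∫ ω, ‖wavg π (fun k => w 0 k ω) - v‖ ^ 2 ∂P
        + κ * ∫ ω, mixSq A π θ m (deviation π (fun k => w 0 k ω)) ∂P) * r ^ n + t)
    (n : ℕ) (k : Fin K) :
    ∫ ω, ‖v - w n k ω‖ ^ 2 ∂P
      ≤ (2 + 2 * ∑ l, (π l)⁻¹) * (1 + κ * ((∑ j ∈ Finset.range m, (θ ^ j)⁻¹) * 4))
          * (∑ l, ∫ ω, ‖v - w 0 l ω‖ ^ 2 ∂P) * r ^ n + (2 + 2 * ∑ l, (π l)⁻¹) * t := by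
  have hπ0 : ∀ k, 0 ≤ π k := fun k => (hπ.pos k).le
  have hc₁ : 0 ≤ ∑ j ∈ Finset.range m, (θ ^ j)⁻¹ := Finset.sum_nonneg fun j _ => by positivity
  have hp : 0 ≤ ∑ l, (π l)⁻¹ := Finset.sum_nonneg fun l _ => (inv_pos.2 (hπ.pos l)).le
  have iV := fun n => integrable_norm_wavg_sub_sq (hL n) π v
  have iS : ∀ n, Integrable (fun ω => wsq π (deviation π (fun k => w n k ω))) P :=
    fun n => integrable_wsq (memLp_deviation (hL n) π) π
  have iD : ∀ n, Integrable (fun ω => mixSq A π θ m (deviation π (fun k => w n k ω))) P :=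
    fun n => integrable_mixSq (memLp_deviation (hL n) π) A π θ m
  have iE : ∀ n k, Integrable (fun ω => ‖v - w n k ω‖ ^ 2) P :=
    fun n k => ((memLp_const v).sub (hL n k)).norm.integrable_sq
  have hTint : ∫ ω, ∑ l, ‖v - w 0 l ω‖ ^ 2 ∂P = ∑ l, ∫ ω, ‖v - w 0 l ω‖ ^ 2 ∂P :=
    integral_finsetSum _ fun l _ => iE 0 l
  have iT : Integrable (fun ω => ∑ l, ‖v - w 0 l ω‖ ^ 2) P :=
    integrable_finsetSum _ fun l _ => iE 0 l
  have hVT := integral_mono (iV 0) iT fun ω => norm_wavg_sub_sq_le hπ (fun k => w 0 k ω) v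
  have hNT : ∫ ω, mixSq A π θ m (deviation π (fun k => w 0 k ω)) ∂P
      ≤ (∑ j ∈ Finset.range m, (θ ^ j)⁻¹) * 4 * ∫ ω, ∑ l, ‖v - w 0 l ω‖ ^ 2 ∂P := by
    rw [← integral_const_mul]
    refine integral_mono (iD 0) (iT.const_mul _) fun ω => ?_
    refine (mixSq_le hA hπ hθ m _).trans ?_
    rw [mul_assoc]
    exact mul_le_mul_of_nonneg_left (wsq_deviation_le hπ _ v) hc₁
  have hV0 : 0 ≤ ∫ ω, ‖wavg π (fun k => w n k ω) - v‖ ^ 2 ∂P :=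
    integral_nonneg fun ω => sq_nonneg _
  have hS0 : 0 ≤ ∫ ω, wsq π (deviation π (fun k => w n k ω)) ∂P :=
    integral_nonneg fun ω => wsq_nonneg hπ0 _
  have hSN := integral_mono (iS n) (iD n) fun ω =>
    wsq_le_mixSq (A := A) hπ0 hθ hm (deviation π (fun k => w n k ω))
  have h1 : ∫ ω, ‖v - w n k ω‖ ^ 2 ∂P
      ≤ 2 * ∫ ω, ‖wavg π (fun k => w n k ω) - v‖ ^ 2 ∂P
        + 2 * (∑ l, (π l)⁻¹) * ∫ ω, wsq π (deviation π (fun k => w n k ω)) ∂P := by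
    have h2 := integral_mono (iE n k) (((iV n).const_mul 2).add
      ((iS n).const_mul (2 * ∑ l, (π l)⁻¹)))
      fun ω => norm_sub_sq_le_deviation hπ (fun k => w n k ω) v k
    rwa [integral_add' ((iV n).const_mul _) ((iS n).const_mul _), integral_const_mul,
      integral_const_mul] at h2
  have hn := hbound n
  rw [hTint] at hVT hNT
  generalize ∑ l, ∫ ω, ‖v - w 0 l ω‖ ^ 2 ∂P = T at *
  generalize ∑ j ∈ Finset.range m, (θ ^ j)⁻¹ = c₁ at *
  generalize ∑ l, (π l)⁻¹ = p at *
  generalize ∫ ω, ‖wavg π (fun k => w 0 k ω) - v‖ ^ 2 ∂P = V₀ at *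
  generalize ∫ ω, ‖wavg π (fun k => w n k ω) - v‖ ^ 2 ∂P = V at *
  generalize ∫ ω, mixSq A π θ m (deviation π (fun k => w 0 k ω)) ∂P = N₀ at *
  generalize ∫ ω, mixSq A π θ m (deviation π (fun k => w n k ω)) ∂P = N at *
  generalize ∫ ω, wsq π (deviation π (fun k => w n k ω)) ∂P = S at *
  have h2 : S ≤ κ * N := hSN.trans (le_mul_of_one_le_left (hS0.trans hSN) hκ)
  have h3 : 2 * V + 2 * p * S ≤ (2 + 2 * p) * (V + κ * N) := by
    have h4 := mul_le_mul_of_nonneg_left h2 hp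
    have h5 := mul_nonneg hp hV0
    linarith [hS0.trans h2]
  have h7 : V₀ + κ * N₀ ≤ (1 + κ * (c₁ * 4)) * T := by
    have := mul_le_mul_of_nonneg_left hNT (zero_le_one.trans hκ)
    linarith
  have h8 : (V₀ + κ * N₀) * r ^ n ≤ (1 + κ * (c₁ * 4)) * T * r ^ n :=
    mul_le_mul_of_nonneg_right h7 (pow_nonneg hr n)
  calc _ ≤ (2 + 2 * p) * (V + κ * N) := h1.trans h3
    _ ≤ (2 + 2 * p) * ((1 + κ * (c₁ * 4)) * T * r ^ n + t) :=
        mul_le_mul_of_nonneg_left (by linarith) (by positivity)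
    _ = _ := by ring

end Stability

end AdvDiffusion

/-! ### Choice of the constants and conclusion -/

theorem theorem1
    {K M : ℕ} (A : Matrix (Fin K) (Fin K) ℝ) (π : Fin K → ℝ)
    (hA : AdvDiffusion.StronglyConnected A) (hπ : AdvDiffusion.IsPerronVector A π)
    (D : Measure (AdvDiffusion.E M × ℝ)) [IsProbabilityMeasure D]
    (Q : Fin K → AdvDiffusion.Loss M) (ε ν L₁ L₂ L₃ L₄ L₅ C : ℝ) (hε : 0 ≤ ε) (hν : 0 < ν)
    (hreg : ∀ k, AdvDiffusion.RegularLoss (Q k) ε D)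
    (hconv : ∀ k, AdvDiffusion.StronglyConvexLoss (Q k) ν)
    (hsmooth : ∀ k, AdvDiffusion.SmoothLoss (Q k) ε L₁ L₂ L₃ L₄ L₅)
    (hdis : ∀ k l, AdvDiffusion.BoundedDisagreement (Q k) (Q l) ε D C)
    (wstar : AdvDiffusion.E M)
    (hmin : ∀ w, AdvDiffusion.aggRisk Q ε D π wstar ≤ AdvDiffusion.aggRisk Q ε D π w) :
    ∃ μ₀ > 0, ∃ a > 0, ∃ b c : ℝ, a * μ₀ < 1 ∧
      ∀ (Ω : Type*) [MeasurableSpace Ω] (P : Measure Ω) [IsProbabilityMeasure P]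
        (ξ : ℕ → Fin K → Ω → AdvDiffusion.E M × ℝ) (w δ : ℕ → Fin K → Ω → AdvDiffusion.E M)
        (μ : ℝ), 0 < μ → μ ≤ μ₀ →
        AdvDiffusion.IIDSamples ξ D P →
        AdvDiffusion.AdmissibleInit (w 0) ξ P →
        AdvDiffusion.IsAdvATC A Q ε μ ξ P w δ →
        AdvDiffusion.UniqueWorstCase Q ε ξ P w →
        (∀ n k, MemLp (w n k) 2 P) ∧
        (∀ k, limsup (fun n => ∫ ω, ‖wstar - w n k ω‖ ^ 2 ∂P) atTop ≤ c * μ) ∧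
        (∀ n k, ∫ ω, ‖wstar - w n k ω‖ ^ 2 ∂P ≤
          b * (∑ l, ∫ ω, ‖wstar - w 0 l ω‖ ^ 2 ∂P) * (1 - a * μ) ^ n + c * μ) := by
  open AdvDiffusion in
  have hπ0 : ∀ k, 0 ≤ π k := fun k => (hπ.pos k).le
  obtain ⟨m, hm, θ, hθ0, hθ1, hcontr⟩ := hA.exists_mixSq_contraction (V := E M) hπ
  -- This Young parameter makes `θ * (1 + s)` the midpoint of `θ` and 1, so the disagreement still
  -- contracts.
  have hs0 : 0 < (1 - θ) / (2 * θ) := div_pos (by linarith) (by linarith)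
  set s := (1 - θ) / (2 * θ) with hs
  have hθs : θ * (1 + s) = (1 + θ) / 2 := by rw [hs]; field_simp; ring
  have hc₁ : 0 ≤ ∑ j ∈ Finset.range m, (θ ^ j)⁻¹ := Finset.sum_nonneg fun j _ => by positivity
  set c₁ := ∑ j ∈ Finset.range m, (θ ^ j)⁻¹ with hc₁_def
  have hH : 0 ≤ gradMoment Q ε L₂ D π wstar :=
    Finset.sum_nonneg fun l _ => mul_nonneg (hπ0 l) (integral_nonneg fun z => sq_nonneg _)
  obtain ⟨μ₀, hμ₀, a, ha, κ, hκ, c, hμ₀1, haμ₀, hrec⟩ := exists_coupled_recursion_bound hν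
    (sq_nonneg L₁) hH (by linarith : 0 ≤ (1 + θ) / 2) (by linarith : (1 + θ) / 2 < 1)
    (by positivity : 0 ≤ 2 + 16 * L₁ ^ 2 / ν + 2 * |L₁| + 3 * L₁ ^ 2)
    (by positivity : 0 ≤ θ * (1 + s⁻¹) * (4 * c₁))
  refine ⟨μ₀, hμ₀, a, ha, (2 + 2 * ∑ l, (π l)⁻¹) * (1 + κ * (c₁ * 4)),
    (2 + 2 * ∑ l, (π l)⁻¹) * c, haμ₀, ?_⟩
  intro Ω _ P _ ξ w δ μ hμ hμle hξ hinit hatc huniq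
  have hμ1 : μ ≤ 1 := hμle.trans hμ₀1
  have haμ : a * μ < 1 := (mul_le_mul_of_nonneg_left hμle ha.le).trans_lt haμ₀
  have haμ0 : 0 < a * μ := mul_pos ha hμ
  have hL := hatc.memLp hε hreg hsmooth hξ hinit huniq
  have iS : ∀ n, Integrable (fun ω => wsq π (deviation π (fun k => w n k ω))) P :=
    fun n => integrable_wsq (memLp_deviation (hL n) π) π
  have iD : ∀ n, Integrable (fun ω => mixSq A π θ m (deviation π (fun k => w n k ω))) P :=
    fun n => integrable_mixSq (memLp_deviation (hL n) π) A π θ m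
  set V : ℕ → ℝ := fun n => ∫ ω, ‖wavg π (fun k => w n k ω) - wstar‖ ^ 2 ∂P with hV
  set S : ℕ → ℝ := fun n => ∫ ω, wsq π (deviation π (fun k => w n k ω)) ∂P with hS
  set N : ℕ → ℝ := fun n => ∫ ω, mixSq A π θ m (deviation π (fun k => w n k ω)) ∂P with hN
  have hV0 : ∀ n, 0 ≤ V n := fun n => integral_nonneg fun ω => sq_nonneg _
  have hS0 : ∀ n, 0 ≤ S n := fun n => integral_nonneg fun ω => wsq_nonneg hπ0 _
  have hSN : ∀ n, S n ≤ N n := fun n => integral_mono (iS n) (iD n) fun ω =>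
    wsq_le_mixSq hπ0 hθ0 hm _
  have hN0 : ∀ n, 0 ≤ N n := fun n => (hS0 n).trans (hSN n)
  have hbound := hrec V N μ hV0 hN0 hμ hμle
    (fun n => by
      have h1 := hatc.centroid_recursion hπ hε hν hreg hconv hsmooth hmin hξ hinit huniq hμ.le
        hμ1 n
      have h2 := mul_le_mul_of_nonneg_left (hSN n)
        (by positivity : 0 ≤ 2 + 16 * L₁ ^ 2 / ν + 2 * |L₁| + 3 * L₁ ^ 2)
      exact h1.trans (by linarith))
    (fun n => by
      have h1 := hatc.disagreement_recursion hA hπ hε hreg hsmooth hξ hinit huniq hθ0 hcontr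
        hs0 wstar n
      rw [hθs] at h1
      refine h1.trans ?_
      have h2 : gradMoment Q ε L₂ D π wstar + L₁ ^ 2 * V n + L₁ ^ 2 * S n
          ≤ gradMoment Q ε L₂ D π wstar + L₁ ^ 2 * V n + L₁ ^ 2 * N n := by
        gcongr
        exact hSN n
      gcongr)
  have hmain : ∀ n k, ∫ ω, ‖wstar - w n k ω‖ ^ 2 ∂P
      ≤ (2 + 2 * ∑ l, (π l)⁻¹) * (1 + κ * (c₁ * 4)) * (∑ l, ∫ ω, ‖wstar - w 0 l ω‖ ^ 2 ∂P)
        * (1 - a * μ) ^ n + (2 + 2 * ∑ l, (π l)⁻¹) * c * μ := fun n k => by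
    rw [mul_assoc _ c μ]
    exact integral_norm_sub_sq_le_of_coupled_bound hA hπ hθ0 hm hL wstar hκ (by linarith)
      hbound n k
  exact ⟨hL, fun k => limsup_le_of_geometric (fun n => integral_nonneg fun ω => sq_nonneg _)
    (by linarith) (by linarith) fun n => hmain n k, hmain⟩
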